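/- Let $n\ge 1$ and let $K\subset\mathbb R^n$ be a $C^2_+$ convex body, that is, a compact convex set with nonempty interior whose boundary is twice continuously differentiable with everywhere strictly positive Gauss curvature, and suppose that its centroid $\frac1{\mathrm{vol}_n(K)}\int_K x\,dx$ is $0$. Let $K^\circ=\{y:\langle y,x\rangle\le 1\ \text{for all } x\in K\}$ be its polar body. Fix $m,k\in\mathbb N\cup\{0\}$ and nonnegative integers $\vec i=(i_j)$ with $i_1+2i_2+\dots+(n-1)i_{n-1}=m$. For a $C^2_+$ convex body $L$ with $0$ in its interior let $N(x)$ be the outer unit normal at $x\in\partial L$, and let $H_j(x)$ be the $j$-th normalized elementary symmetric function of the principal curvatures of $\partial L$ at $x$ (so $H_{n-1}$ is the Gauss curvature). Let $\mu_{\vec i}=\mu_{\vec i,L}$ be the measure on $\partial L$ with $$d\mu_{\vec i}(x)=\prod_{j=1}^{n-1}\binom{n-1}{j}^{i_j}\,\langle x,N(x)\rangle^{m-k}\prod_{j=1}^{n-1}H_j(x)^{i_j}\,d\mathcal H^{n-1}(x),$$ and for $p\in\mathbb R$, $p\ne -n$, put $$\omega^p_{m,k,\vec i}(L)=\int_{\partial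 L}\frac{H_{n-1}(x)^{\frac p{n+p}}}{\langle x,N(x)\rangle^{\frac{n(p-1)}{n+p}}}\,d\mu_{\vec i}(x),\qquad \omega^\infty_{m,k,\vec i}(L)=\int_{\partial L}\frac{H_{n-1}(x)}{\langle x,N(x)\rangle^{n}}\,d\mu_{\vec i}(x).$$ Let $P_L=p_L\,\mu_{\vec i}$ and $Q_L=q_L\,\mu_{\vec i}$ with $p_L(x)=H_{n-1}(x)/\langle x,N(x)\rangle^n$ and $q_L(x)=\langle x,N(x)\rangle$, and let $D_{KL}(P_L\|Q_L)=\int_{\partial L} p_L\log\frac{p_L}{q_L}\,d\mu_{\vec i}$ and $D_{KL}(Q_L\|P_L)=\int_{\partial L} q_L\log\frac{q_L}{p_L}\,d\mu_{\vec i}$. Then the integrals defining $D_{KL}(P_K\|Q_K)$ and $D_{KL}(Q_{K^\circ}\|P_{K^\circ})$ converge absolutely, and (i) $$\lim_{p\to\infty}\left(\frac{\omega^p_{m,k,\vec i}(K)}{\omega^\infty_{m,k,\vec i}(K)}\right)^{n+p}=\exp\left(-\frac{n\,D_{KL}(P_K\|Q_K)}{\omega^\infty_{m,k,\vec i}(K)}\right);$$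 (ii) $$\lim_{p\to0}\left(\frac{\omega^p_{m,k,\vec i}(K^\circ)}{\omega^0_{m,k,\vec i}(K^\circ)}\right)^{\frac{n(n+p)}p}=\exp\left(-\frac{n\,D_{KL}(Q_{K^\circ}\|P_{K^\circ})}{\omega^0_{m,k,\vec i}(K^\circ)}\right).$$ -/

import Mathlib

open MeasureTheory Filter Topology
open scoped RealInnerProductSpace

noncomputable section

namespace WeightedAffineSurface

/-- Euclidean space `ℝⁿ`. -/
abbrev E (n : ℕ) : Type := EuclideanSpace ℝ (Fin n)

variable {n : ℕ}

/-- A convex body: a compact convex set with nonempty interior. -/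
def IsConvexBody (K : Set (E n)) : Prop :=
  Convex ℝ K ∧ IsCompact K ∧ (interior K).Nonempty

/-- The polar body `K° = {y : ⟪y, x⟫ ≤ 1 for all x ∈ K}`. -/
def polarBody (K : Set (E n)) : Set (E n) :=
  {y | ∀ x ∈ K, ⟪y, x⟫ ≤ 1}

/-- `u` is an outward unit normal vector of `K` at `x`. -/
def IsOuterUnitNormal (K : Set (E n)) (x u : E n) : Prop :=
  ‖u‖ = 1 ∧ ∀ y ∈ K, ⟪y - x, u⟫ ≤ 0

open Classical in
/-- The Gauss map `N_K`. At a boundary point of a convex body of class `C²` the outward unit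
normal is unique, so that the choice below is the unique one. -/
def gaussMap (K : Set (E n)) (x : E n) : E n :=
  if h : ∃ u, IsOuterUnitNormal K x u then h.choose else 0

/-- The boundary of the closed set `K` is of class `C²`: near each boundary point, `K` is the
sublevel set of a `C²` function with nonvanishing differential. -/
def HasC2Boundary (K : Set (E n)) : Prop :=
  ∀ x ∈ frontier K, ∃ φ : E n → ℝ,
    ContDiffAt ℝ 2 φ x ∧ fderiv ℝ φ x ≠ 0 ∧ ∀ᶠ y in 𝓝 x, (y ∈ K ↔ φ y ≤ 0)

/-- The tangent space of `∂K` at `x`, as the orthogonal complement of the normal. -/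
abbrev tangentSpace (K : Set (E n)) (x : E n) : Submodule ℝ (E n) :=
  (Submodule.span ℝ {gaussMap K x})ᗮ

/-- The Weingarten map: the differential at `x` of the Gauss map along `∂K`, as an endomorphism
of the tangent space. A derivative within `∂K` is determined on tangent vectors only, and it maps
them to tangent vectors, because the Gauss map takes values in the unit sphere; the orthogonal
projection just provides the codomain. -/
def weingarten (K : Set (E n)) (x : E n) :
    tangentSpace K x →ₗ[ℝ] tangentSpace K x :=
  (tangentSpace K x).orthogonalProjectionOnto.toLinearMap ∘ₗ
    (fderivWithin ℝ (gaussMap K) (frontier K) x).toLinearMap ∘ₗ (tangentSpace K x).subtype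

/-- The principal curvatures: the eigenvalues of the Weingarten map, with multiplicity. -/
def principalCurvatures (K : Set (E n)) (x : E n) : Multiset ℝ :=
  (weingarten K x).charpoly.roots

/-- `H_j`, the `j`-th normalized elementary symmetric function of the principal curvatures. -/
def symmCurv (K : Set (E n)) (j : ℕ) (x : E n) : ℝ :=
  ((n - 1).choose j : ℝ)⁻¹ * (principalCurvatures K x).esymm j

/-- The Gauss curvature `H_{n-1}`. -/
def gaussCurv (K : Set (E n)) (x : E n) : ℝ := symmCurv K (n - 1) x

/-- `K` is a convex body of class `C²₊`. -/
def IsC2PlusBody (K : Set (E n)) : Prop :=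
  IsConvexBody K ∧ HasC2Boundary K ∧ ∀ x ∈ frontier K, 0 < gaussCurv K x

/-- `⟪x, N(x)⟫`. -/
def supp (K : Set (E n)) (x : E n) : ℝ := ⟪x, gaussMap K x⟫

/-- The measure `μ_{m,k,i}` on `∂K`, with density
`∏ⱼ (n-1 choose j)^{i_j} · ⟪x, N(x)⟫^{m-k} · ∏ⱼ H_j(x)^{i_j}` with respect to the surface measure. -/
def weightMeasure (m k : ℕ) (i : ℕ → ℕ) (K : Set (E n)) : Measure (E n) :=
  ((μHE[n - 1] : Measure (E n)).restrict (frontier K)).withDensity fun x =>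
    ENNReal.ofReal ((∏ j ∈ Finset.Icc 1 (n - 1), ((n - 1).choose j : ℝ) ^ i j) *
      supp K x ^ ((m : ℤ) - (k : ℤ)) * ∏ j ∈ Finset.Icc 1 (n - 1), symmCurv K j x ^ i j)

/-- The weighted `L_p` affine surface area `ω^p_{m,k,i}(K)`. -/
def omega (m k : ℕ) (i : ℕ → ℕ) (p : ℝ) (K : Set (E n)) : ℝ :=
  ∫ x, gaussCurv K x ^ (p / (n + p)) / supp K x ^ (n * (p - 1) / (n + p))
    ∂(weightMeasure m k i K)

/-- The density `p_K = H_{n-1} / ⟪x, N(x)⟫ⁿ` of `P_K` with respect to `μ_{m,k,i}`. -/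
def densP (K : Set (E n)) (x : E n) : ℝ := gaussCurv K x / supp K x ^ n

/-- The density `q_K = ⟪x, N(x)⟫` of `Q_K` with respect to `μ_{m,k,i}`. -/
def densQ (K : Set (E n)) (x : E n) : ℝ := supp K x

/-- `ω^∞_{m,k,i}(K)`. -/
def omegaInfty (m k : ℕ) (i : ℕ → ℕ) (K : Set (E n)) : ℝ :=
  ∫ x, gaussCurv K x / supp K x ^ n ∂(weightMeasure m k i K)

/-- The integrand `p log (p / q)` of the relative entropy. -/
def klIntegrand {X : Type*} (p q : X → ℝ) (x : X) : ℝ := p x * Real.log (p x / q x)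

/-- The Kullback-Leibler divergence `D_KL(p μ ‖ q μ) = ∫ p log (p / q) dμ` (for measures that
need not be probability measures). -/
def klDivergence {X : Type*} [MeasurableSpace X] (μ : Measure X) (p q : X → ℝ) : ℝ :=
  ∫ x, klIntegrand p q x ∂μ

end WeightedAffineSurface

end

open WeightedAffineSurface

namespace WeightedAffineSurface

/-! Both limits are one derivative. Put `ε = n/(n+p)`. The integrand of `ω^p` is the geometric mean
`p_L^(1-ε) q_L^ε`, so `ω^p = F(ε)` with `F(ε) = ∫ p_L (q_L/p_L)^ε dμ` and `F(0) = ω^∞`. Since `n/ε =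
n+p`, the first limit is that of `(F(ε)/F(0))^(n/ε)`, namely `exp(n F'(0)/F(0))`, and `F'(0) = ∫ p_L
log(q_L/p_L) dμ = -D_KL(P‖Q)`. Exchanging the densities and taking `ε = p/(n+p)` gives the second
limit. The analysis is in `AEPosBounded.hasDerivAt_integral_rpow` and
`tendsto_rpow_div_of_hasDerivAt`.

This requires `μ` to be finite and nonzero, and `H_{n-1}` and `⟪x, N⟫` to lie a.e. between positive
constants. Both functions are continuous and positive on the compact boundary once `0` is interior,
which for `K` follows from the centroid condition. Monotonicity of the Gauss map makes the
curvatures nonnegative, and positive Gauss curvature then makes all of them, hence every `H_j`,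
positive.

For `K°` a weaker regularity suffices: a `C¹` Gauss map with symmetric differential
(`IsRegularBody`). The duality map `x ↦ N(x)/⟪x, N(x)⟫` from `∂K` to `∂K°` is inverted by the
inverse function theorem (`IsNormalChart.exists_dual_inverse`). Its normalized inverse is the Gauss
map of `K°`, and the second fundamental form of `K°` is a positive multiple of a pullback of that of
`K`, hence nondegenerate (`IsRegularBody.exists_polar_chart`). -/

/-- A function is a.e. bounded between two positive constants. -/
def AEPosBounded {X : Type*} [MeasurableSpace X] (μ : Measure X) (f : X → ℝ) : Prop :=
  AEStronglyMeasurable f μ ∧ ∃ c C : ℝ, 0 < c ∧ ∀ᵐ x ∂μ, c ≤ f x ∧ f x ≤ C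

/-! ### Differentiating `∫ a f ^ ε` at `ε = 0` -/

section Limit

variable {X : Type*} [MeasurableSpace X] {μ : Measure X} {a f g : X → ℝ}

theorem AEPosBounded.pos (hf : AEPosBounded μ f) : ∀ᵐ x ∂μ, 0 < f x := by
  obtain ⟨-, c, C, hc, h⟩ := hf
  filter_upwards [h] with x hx using hc.trans_le hx.1

theorem AEPosBounded.integrable [IsFiniteMeasure μ] (hf : AEPosBounded μ f) :
    Integrable f μ := by
  obtain ⟨hm, c, C, hc, h⟩ := hf
  refine Integrable.of_bound hm C ?_
  filter_upwards [h] with x hx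
  rw [Real.norm_of_nonneg (hc.le.trans hx.1)]
  exact hx.2

theorem AEPosBounded.integral_pos [IsFiniteMeasure μ] [NeZero μ] (hf : AEPosBounded μ f) :
    0 < ∫ x, f x ∂μ := by
  have hi := hf.integrable
  obtain ⟨hm, c, C, hc, h⟩ := hf
  have h1 : ∫ _, c ∂μ ≤ ∫ x, f x ∂μ :=
    integral_mono_ae (integrable_const c) hi (h.mono fun x hx => hx.1)
  refine lt_of_lt_of_le ?_ h1
  rw [integral_const, smul_eq_mul]
  exact mul_pos (by rw [measureReal_def]; exact ENNReal.toReal_pos (NeZero.ne _ ∘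
    Measure.measure_univ_eq_zero.mp) (measure_ne_top _ _)) hc

theorem AEPosBounded.div (hf : AEPosBounded μ f) (hg : AEPosBounded μ g) :
    AEPosBounded μ (fun x => f x / g x) := by
  obtain ⟨hfm, c, C, hc, hf⟩ := hf
  obtain ⟨hgm, d, D, hd, hg⟩ := hg
  -- `D` may fail to be positive when `μ = 0`; `max D 1` keeps the lower constant positive.
  refine ⟨(hfm.aemeasurable.div hgm.aemeasurable).aestronglyMeasurable,
    c / max D 1, C / d, by positivity, ?_⟩
  filter_upwards [hf, hg] with x hx hy
  have : 0 < g x := hd.trans_le hy.1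
  exact ⟨div_le_div₀ (hc.le.trans hx.1) hx.1 this (hy.2.trans (le_max_left _ _)),
    div_le_div₀ (hc.le.trans (hx.1.trans hx.2)) hx.2 hd hy.1⟩

theorem abs_log_le_of_mem {c C t : ℝ} (hc : 0 < c) (h : c ≤ t ∧ t ≤ C) :
    |Real.log t| ≤ |Real.log c| + |Real.log C| := by
  have h1 := Real.log_le_log hc h.1
  have h2 := Real.log_le_log (hc.trans_le h.1) h.2
  rw [abs_le]
  constructor
  · linarith [neg_abs_le (Real.log c), abs_nonneg (Real.log C)]
  · linarith [le_abs_self (Real.log C), abs_nonneg (Real.log c)]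

theorem AEPosBounded.integrable_mul_log [IsFiniteMeasure μ] (ha : AEPosBounded μ a)
    (hf : AEPosBounded μ f) : Integrable (fun x => a x * Real.log (f x)) μ := by
  have hi := ha.integrable
  obtain ⟨hfm, c, C, hc, hf⟩ := hf
  refine hi.mul_bdd (c := |Real.log c| + |Real.log C|)
    (Real.measurable_log.comp_aemeasurable hfm.aemeasurable).aestronglyMeasurable ?_
  filter_upwards [hf] with x hx
  exact abs_log_le_of_mem hc hx

/-- The derivative at `0` of `ε ↦ ∫ a f ^ ε`. -/
theorem AEPosBounded.hasDerivAt_integral_rpow [IsFiniteMeasure μ] (ha : AEPosBounded μ a)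
    (hf : AEPosBounded μ f) :
    HasDerivAt (fun ε : ℝ => ∫ x, a x * f x ^ ε ∂μ) (∫ x, a x * Real.log (f x) ∂μ) 0 := by
  have hai := ha.integrable
  have hfp := hf.pos
  obtain ⟨ham, c', A, hc', ha⟩ := ha
  obtain ⟨hfm, c, C, hc, hf⟩ := hf
  set B := |Real.log c| + |Real.log C| with hB
  -- For `|ε| < 1`, `f ^ ε = exp (ε log f) ≤ exp B`, which gives a constant dominating function.
  have key := hasDerivAt_integral_of_dominated_loc_of_deriv_le (μ := μ) (x₀ := (0 : ℝ))
    (F := fun ε x => a x * f x ^ ε) (F' := fun ε x => a x * (f x ^ ε * Real.log (f x)))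
    (bound := fun _ => A * (Real.exp B * B)) (Metric.ball_mem_nhds (0 : ℝ) one_pos)
    (Eventually.of_forall fun ε => ham.mul
      (hfm.aemeasurable.pow_const ε).aestronglyMeasurable)
    (by simpa using hai)
    (ham.mul ((hfm.aemeasurable.pow_const 0).mul
      (Real.measurable_log.comp_aemeasurable hfm.aemeasurable)).aestronglyMeasurable)
    ?_ (integrable_const _) ?_
  · simpa using key.2
  · filter_upwards [ha, hf] with x hx hy ε hε
    have hx0 : 0 < a x := hc'.trans_le hx.1
    have hy0 : 0 < f x := hc.trans_le hy.1
    have hl := abs_log_le_of_mem hc hy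
    rw [← hB] at hl
    rw [norm_mul, norm_mul, Real.norm_of_nonneg hx0.le, Real.norm_eq_abs (Real.log _),
      Real.norm_of_nonneg (Real.rpow_pos_of_pos hy0 ε).le, Real.rpow_def_of_pos hy0]
    have hε' : |ε| ≤ 1 := by
      rw [mem_ball_zero_iff, Real.norm_eq_abs] at hε; exact hε.le
    have : Real.log (f x) * ε ≤ B := by
      refine (le_abs_self _).trans ?_
      rw [abs_mul]
      calc _ ≤ B * 1 := mul_le_mul hl hε' (abs_nonneg _) (by positivity)
        _ = B := mul_one B
    have hA : 0 ≤ A := hx0.le.trans hx.2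
    gcongr
    exact hx.2
  · filter_upwards [hfp] with x hx ε _
    exact ((Real.hasStrictDerivAt_const_rpow hx ε).hasDerivAt).const_mul (a x)

/-- If `F` is differentiable at `0` and positive there, then
`(F ε / F 0) ^ (c / ε) → exp (c F'(0) / F(0))`. -/
theorem tendsto_rpow_div_of_hasDerivAt {F : ℝ → ℝ} {F' c : ℝ} (hF : HasDerivAt F F' 0)
    (h0 : 0 < F 0) :
    Tendsto (fun ε => (F ε / F 0) ^ (c / ε)) (𝓝[≠] 0) (𝓝 (Real.exp (c * F' / F 0))) := by
  have h1 : HasDerivAt (fun ε => Real.log (F ε / F 0)) (F' / F 0) 0 := by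
    have := (hF.div_const (F 0)).log (by simp [h0.ne'])
    simpa [h0.ne'] using this
  have h2 : Tendsto (fun ε => Real.exp (c * (ε⁻¹ * Real.log (F ε / F 0)))) (𝓝[≠] 0)
      (𝓝 (Real.exp (c * (F' / F 0)))) := by
    have := h1.tendsto_slope_zero
    simp only [zero_add, div_self h0.ne', Real.log_one, sub_zero, smul_eq_mul] at this
    exact (Real.continuous_exp.tendsto _).comp (this.const_mul c)
  rw [mul_div_assoc]
  refine h2.congr' ?_
  have h3 : ∀ᶠ ε in 𝓝[≠] (0 : ℝ), 0 < F ε :=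
    (hF.continuousAt.eventually (lt_mem_nhds h0)).filter_mono nhdsWithin_le_nhds
  filter_upwards [h3] with ε hε
  rw [Real.rpow_def_of_pos (div_pos hε h0)]
  congr 1
  ring

theorem AEPosBounded.tendsto_rpow [IsFiniteMeasure μ] [NeZero μ] (ha : AEPosBounded μ a)
    (hf : AEPosBounded μ f) (c : ℝ) :
    Tendsto (fun ε : ℝ => ((∫ x, a x * f x ^ ε ∂μ) / ∫ x, a x ∂μ) ^ (c / ε)) (𝓝[≠] 0)
      (𝓝 (Real.exp (c * (∫ x, a x * Real.log (f x) ∂μ) / ∫ x, a x ∂μ))) := by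
  have := tendsto_rpow_div_of_hasDerivAt (c := c) (ha.hasDerivAt_integral_rpow hf)
    (by simpa using ha.integral_pos)
  simpa using this

end Limit

variable {n : ℕ}

/-! ### The two entropy limits under uniform bounds -/

section Entropy

variable {m k : ℕ} {i : ℕ → ℕ} {L : Set (E n)}

theorem AEPosBounded.pow {X : Type*} [MeasurableSpace X] {μ : Measure X} {f : X → ℝ}
    (hf : AEPosBounded μ f) (N : ℕ) : AEPosBounded μ (fun x => f x ^ N) := by
  obtain ⟨hfm, c, C, hc, hf⟩ := hf
  refine ⟨hfm.pow N, c ^ N, C ^ N, by positivity, ?_⟩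
  filter_upwards [hf] with x hx
  exact ⟨pow_le_pow_left₀ hc.le hx.1 N, pow_le_pow_left₀ (hc.le.trans hx.1) hx.2 N⟩

/-- The integrand of `ω^p` as a geometric mean of the densities `p_L` and `q_L`. -/
theorem rpow_div_rpow_eq {H h p : ℝ} (hH : 0 < H) (hh : 0 < h) (hp : (n : ℝ) + p ≠ 0) :
    H ^ (p / (n + p)) / h ^ (n * (p - 1) / (n + p)) =
      (H / h ^ n) ^ (p / (n + p)) * h ^ (n / (n + p)) := by
  rw [Real.div_rpow hH.le (by positivity), ← Real.rpow_natCast h n, ← Real.rpow_mul hh.le,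
    div_mul_eq_mul_div, div_eq_div_iff (Real.rpow_pos_of_pos hh _).ne'
      (Real.rpow_pos_of_pos hh _).ne', mul_assoc, ← Real.rpow_add hh]
  congr 2
  field_simp
  ring

theorem rpow_mul_rpow_one_sub {s t ε : ℝ} (hs : 0 < s) (ht : 0 < t) :
    s ^ (1 - ε) * t ^ ε = s * (t / s) ^ ε := by
  rw [Real.rpow_sub hs, Real.rpow_one, Real.div_rpow ht.le hs.le]
  ring

/-- The exponent `n/(n+p)` vanishes as `p → ∞`, so this form expands around `ω^∞`; the exponent
`p/(n+p)` of the companion form expands around `p = 0`. -/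
theorem omega_eq_integral_densP (hH : ∀ᵐ x ∂(weightMeasure m k i L), 0 < gaussCurv L x)
    (hs : ∀ᵐ x ∂(weightMeasure m k i L), 0 < supp L x) {p : ℝ} (hp : (n : ℝ) + p ≠ 0) :
    omega m k i p L = ∫ x, densP L x * (densQ L x / densP L x) ^ ((n : ℝ) / (n + p))
      ∂(weightMeasure m k i L) := by
  refine integral_congr_ae ?_
  filter_upwards [hH, hs] with x hx hy
  rw [rpow_div_rpow_eq hx hy hp, densP, densQ, ← rpow_mul_rpow_one_sub (by positivity) hy]
  congr 2
  field_simp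
  ring

theorem omega_eq_integral_densQ (hH : ∀ᵐ x ∂(weightMeasure m k i L), 0 < gaussCurv L x)
    (hs : ∀ᵐ x ∂(weightMeasure m k i L), 0 < supp L x) {p : ℝ} (hp : (n : ℝ) + p ≠ 0) :
    omega m k i p L = ∫ x, densQ L x * (densP L x / densQ L x) ^ (p / (n + p))
      ∂(weightMeasure m k i L) := by
  refine integral_congr_ae ?_
  filter_upwards [hH, hs] with x hx hy
  rw [rpow_div_rpow_eq hx hy hp, densP, densQ, ← rpow_mul_rpow_one_sub hy (by positivity),
    mul_comm]
  congr 2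
  field_simp
  ring

variable [IsFiniteMeasure (weightMeasure m k i L)] [NeZero (weightMeasure m k i L)]

theorem integrable_klIntegrand_and_tendsto_atTop (hn : 1 ≤ n)
    (hH : AEPosBounded (weightMeasure m k i L) (gaussCurv L))
    (hs : AEPosBounded (weightMeasure m k i L) (supp L)) :
    Integrable (klIntegrand (densP L) (densQ L)) (weightMeasure m k i L) ∧
      Tendsto (fun p : ℝ => (omega m k i p L / omegaInfty m k i L) ^ ((n : ℝ) + p)) atTop
        (𝓝 (Real.exp (-((n : ℝ) * klDivergence (weightMeasure m k i L) (densP L) (densQ L) /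
          omegaInfty m k i L)))) := by
  have hP : AEPosBounded (weightMeasure m k i L) (densP L) := hH.div (hs.pow n)
  have hQ : AEPosBounded (weightMeasure m k i L) (densQ L) := hs
  refine ⟨hP.integrable_mul_log (hP.div hQ), ?_⟩
  have hn0 : (0 : ℝ) < n := by exact_mod_cast hn
  have hε : Tendsto (fun p : ℝ => (n : ℝ) / (n + p)) atTop (𝓝[≠] 0) := by
    refine tendsto_nhdsWithin_iff.mpr
      ⟨(tendsto_atTop_add_const_left _ _ tendsto_id).const_div_atTop _, ?_⟩
    filter_upwards [eventually_gt_atTop 0] with p hp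
    have : (n : ℝ) / (n + p) ≠ 0 := by positivity
    exact this
  have key := (hP.tendsto_rpow (hQ.div hP) n).comp hε
  have hD : -((n : ℝ) * klDivergence (weightMeasure m k i L) (densP L) (densQ L)) =
      n * ∫ x, densP L x * Real.log (densQ L x / densP L x) ∂(weightMeasure m k i L) := by
    rw [klDivergence, ← mul_neg, ← integral_neg]
    congr 2 with x
    rw [klIntegrand, ← mul_neg, ← Real.log_inv, inv_div]
  rw [← neg_div, hD]
  refine key.congr' ?_
  filter_upwards [eventually_gt_atTop 0] with p hp
  have hp' : (n : ℝ) + p ≠ 0 := by positivity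
  rw [omega_eq_integral_densP hH.pos hs.pos hp', Function.comp_apply, div_div_cancel₀ hn0.ne']
  rfl

theorem integrable_klIntegrand_and_tendsto_zero (hn : 1 ≤ n)
    (hH : AEPosBounded (weightMeasure m k i L) (gaussCurv L))
    (hs : AEPosBounded (weightMeasure m k i L) (supp L)) :
    Integrable (klIntegrand (densQ L) (densP L)) (weightMeasure m k i L) ∧
      Tendsto (fun p : ℝ => (omega m k i p L / omega m k i 0 L) ^
          ((n : ℝ) * ((n : ℝ) + p) / p)) (𝓝[≠] 0)
        (𝓝 (Real.exp (-((n : ℝ) * klDivergence (weightMeasure m k i L)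
          (densQ L) (densP L) / omega m k i 0 L)))) := by
  have hP : AEPosBounded (weightMeasure m k i L) (densP L) := hH.div (hs.pow n)
  have hQ : AEPosBounded (weightMeasure m k i L) (densQ L) := hs
  refine ⟨hQ.integrable_mul_log (hQ.div hP), ?_⟩
  have hn0 : (0 : ℝ) < n := by exact_mod_cast hn
  have hnear : ∀ᶠ p in 𝓝[≠] (0 : ℝ), 0 < (n : ℝ) + p := by
    refine Eventually.filter_mono nhdsWithin_le_nhds ?_
    exact (continuous_const.add continuous_id).continuousAt.eventually
      (lt_mem_nhds (by simpa using hn0))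
  have hε : Tendsto (fun p : ℝ => p / ((n : ℝ) + p)) (𝓝[≠] 0) (𝓝[≠] 0) := by
    refine tendsto_nhdsWithin_iff.mpr ⟨?_, ?_⟩
    · have : ContinuousAt (fun p : ℝ => p / ((n : ℝ) + p)) 0 :=
        continuousAt_id.div (continuousAt_const.add continuousAt_id) (by simpa using hn0.ne')
      simpa using this.tendsto.mono_left nhdsWithin_le_nhds
    · filter_upwards [hnear, self_mem_nhdsWithin] with p hp hp0
      exact div_ne_zero hp0 hp.ne'
  have key := (hQ.tendsto_rpow (hP.div hQ) n).comp hε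
  have h0 : omega m k i 0 L = ∫ x, densQ L x ∂(weightMeasure m k i L) := by
    rw [omega_eq_integral_densQ hH.pos hs.pos (by simpa using hn0.ne')]
    simp
  have hD : -((n : ℝ) * klDivergence (weightMeasure m k i L) (densQ L) (densP L)) =
      n * ∫ x, densQ L x * Real.log (densP L x / densQ L x) ∂(weightMeasure m k i L) := by
    rw [klDivergence, ← mul_neg, ← integral_neg]
    congr 2 with x
    rw [klIntegrand, ← mul_neg, ← Real.log_inv, inv_div]
  rw [← neg_div, hD, h0]
  refine key.congr' ?_
  filter_upwards [hnear, self_mem_nhdsWithin] with p hp hp0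
  rw [omega_eq_integral_densQ hH.pos hs.pos hp.ne', Function.comp_apply, div_div_eq_mul_div]

end Entropy

/-! ### Convex bodies with `C¹` Gauss map: normals and tangent directions -/

/-- `G` is a `C¹` extension of the Gauss map of `L` to a neighbourhood of the boundary point `x`,
outward normals near `x` are unique, and the second fundamental form at `x` is symmetric. -/
structure IsNormalChart (L : Set (E n)) (x : E n) (G : E n → E n) : Prop where
  contDiffAt : ContDiffAt ℝ 1 G x
  eq_normal : ∀ᶠ y in 𝓝[frontier L] x, ∀ u, IsOuterUnitNormal L y u → u = G y
  symm : ∀ v w, ⟪v, G x⟫ = 0 → ⟪w, G x⟫ = 0 → ⟪fderiv ℝ G x v, w⟫ = ⟪v, fderiv ℝ G x w⟫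

/-- A convex body with `0` in its interior whose Gauss map is of class `C¹`, with symmetric
second fundamental form. -/
structure IsRegularBody (L : Set (E n)) : Prop where
  convex : Convex ℝ L
  isCompact : IsCompact L
  zero_mem : (0 : E n) ∈ interior L
  exists_chart : ∀ x ∈ frontier L, ∃ G, IsNormalChart L x G

section Normal

variable {L : Set (E n)} {x u : E n}

theorem exists_isOuterUnitNormal (hc : Convex ℝ L) (hi : (interior L).Nonempty)
    (hx : x ∈ frontier L) : ∃ u, IsOuterUnitNormal L x u := by
  obtain ⟨f, hf⟩ := geometric_hahn_banach_open_point hc.interior isOpen_interior hx.2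
  have hle : ∀ y ∈ L, f y ≤ f x := by
    have h1 : L ⊆ closure (interior L) := by
      rw [hc.closure_interior_eq_closure_of_nonempty_interior hi]
      exact subset_closure
    have h2 : closure (interior L) ⊆ {y | f y ≤ f x} :=
      closure_minimal (fun y hy => (hf y hy).le) (isClosed_le f.continuous continuous_const)
    exact fun y hy => h2 (h1 hy)
  set w := (InnerProductSpace.toDual ℝ (E n)).symm f with hw
  have hfw : ∀ y, f y = ⟪w, y⟫ := fun y => (InnerProductSpace.toDual_symm_apply).symm
  have hw0 : w ≠ 0 := by
    rintro h0
    obtain ⟨a, ha⟩ := hi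
    have := hf a ha
    simp [hfw, h0] at this
  refine ⟨‖w‖⁻¹ • w, by rw [norm_smul, norm_inv, norm_norm, inv_mul_cancel₀ (norm_ne_zero_iff.2 hw0)],
    fun y hy => ?_⟩
  rw [real_inner_smul_right, real_inner_comm, inner_sub_right, ← hfw, ← hfw]
  exact mul_nonpos_of_nonneg_of_nonpos (by positivity) (sub_nonpos.2 (hle y hy))

theorem isOuterUnitNormal_gaussMap (hc : Convex ℝ L) (hi : (interior L).Nonempty)
    (hx : x ∈ frontier L) : IsOuterUnitNormal L x (gaussMap L x) := by
  have h := exists_isOuterUnitNormal hc hi hx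
  rw [gaussMap, dif_pos h]
  exact h.choose_spec

/-- The support inequality is tested at `(r/2) u`, which lies in a ball around `0` inside `L`. -/
theorem inner_pos_of_isOuterUnitNormal (h0 : (0 : E n) ∈ interior L)
    (hu : IsOuterUnitNormal L x u) : 0 < ⟪x, u⟫ := by
  obtain ⟨r, hr, hrL⟩ := Metric.mem_nhds_iff.1 (mem_interior_iff_mem_nhds.1 h0)
  have hmem : (r / 2) • u ∈ L := by
    apply hrL
    rw [mem_ball_zero_iff, norm_smul, hu.1, mul_one, Real.norm_of_nonneg (by positivity)]
    linarith
  have := hu.2 _ hmem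
  rw [inner_sub_left, real_inner_smul_left, real_inner_self_eq_norm_sq, hu.1] at this
  linarith

end Normal

namespace IsRegularBody

variable {L : Set (E n)} {x : E n}

theorem interior_nonempty (hL : IsRegularBody L) : (interior L).Nonempty := ⟨0, hL.zero_mem⟩

theorem mem_nhds_zero (hL : IsRegularBody L) : L ∈ 𝓝 (0 : E n) :=
  mem_interior_iff_mem_nhds.1 hL.zero_mem

theorem isCompact_frontier (hL : IsRegularBody L) : IsCompact (frontier L) :=
  hL.isCompact.of_isClosed_subset isClosed_frontier hL.isCompact.isClosed.frontier_subset

theorem isOuterUnitNormal (hL : IsRegularBody L) (hx : x ∈ frontier L) :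
    IsOuterUnitNormal L x (gaussMap L x) :=
  isOuterUnitNormal_gaussMap hL.convex hL.interior_nonempty hx

theorem supp_pos (hL : IsRegularBody L) (hx : x ∈ frontier L) : 0 < supp L x :=
  inner_pos_of_isOuterUnitNormal hL.zero_mem (hL.isOuterUnitNormal hx)

theorem frontier_subset (hL : IsRegularBody L) : frontier L ⊆ L :=
  hL.isCompact.isClosed.frontier_subset

end IsRegularBody

namespace IsNormalChart

variable {L : Set (E n)} {x : E n} {G : E n → E n}

theorem gaussMap_eventuallyEq (hG : IsNormalChart L x G) (hL : IsRegularBody L) :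
    gaussMap L =ᶠ[𝓝[frontier L] x] G := by
  filter_upwards [hG.eq_normal, self_mem_nhdsWithin] with y hy hyL
  exact hy _ (hL.isOuterUnitNormal hyL)

theorem gaussMap_eq (hG : IsNormalChart L x G) (hL : IsRegularBody L) (hx : x ∈ frontier L) :
    gaussMap L x = G x :=
  (hG.gaussMap_eventuallyEq hL).self_of_nhdsWithin hx

theorem continuousWithinAt_gaussMap (hG : IsNormalChart L x G) (hL : IsRegularBody L)
    (hx : x ∈ frontier L) : ContinuousWithinAt (gaussMap L) (frontier L) x :=
  hG.contDiffAt.continuousAt.continuousWithinAt.congr_of_eventuallyEq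
    (hG.gaussMap_eventuallyEq hL) (hG.gaussMap_eq hL hx)

theorem hasFDerivAt (hG : IsNormalChart L x G) : HasFDerivAt G (fderiv ℝ G x) x :=
  (hG.contDiffAt.differentiableAt (by norm_num)).hasFDerivAt

theorem hasFDerivWithinAt_gaussMap (hG : IsNormalChart L x G) (hL : IsRegularBody L)
    (hx : x ∈ frontier L) :
    HasFDerivWithinAt (gaussMap L) (fderiv ℝ G x) (frontier L) x :=
  hG.hasFDerivAt.hasFDerivWithinAt.congr_of_eventuallyEq
    (hG.gaussMap_eventuallyEq hL) (hG.gaussMap_eq hL hx)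

end IsNormalChart

namespace IsRegularBody

variable {L : Set (E n)} {x v : E n}

theorem continuousOn_gaussMap (hL : IsRegularBody L) :
    ContinuousOn (gaussMap L) (frontier L) := fun x hx => by
  obtain ⟨G, hG⟩ := hL.exists_chart x hx
  exact hG.continuousWithinAt_gaussMap hL hx

/-- Every tangent vector is the velocity of a curve in the boundary, obtained by radially
projecting a line. -/
theorem exists_curve (hL : IsRegularBody L) (hx : x ∈ frontier L) (hv : ⟪v, gaussMap L x⟫ = 0) :
    ∃ d : ℝ → E n, Tendsto d (𝓝[>] 0) (𝓝 0) ∧ (∀ᶠ t in 𝓝[>] 0, x + d t ∈ frontier L) ∧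
      Tendsto (fun t => t⁻¹ • d t) (𝓝[>] 0) (𝓝 v) := by
  set g : ℝ → ℝ := fun t => gauge L (x + t • v) with hg
  set y : ℝ → E n := fun t => (g t)⁻¹ • (x + t • v) with hy
  have hgx : gauge L x = 1 := (gauge_eq_one_iff_mem_frontier hL.convex hL.mem_nhds_zero).2 hx
  have hgc : Continuous g := by
    have := continuous_gauge hL.convex hL.mem_nhds_zero
    fun_prop
  have hg0 : g 0 = 1 := by simp [hg, hgx]
  have hgt : Tendsto g (𝓝[>] 0) (𝓝 1) := by
    have := hgc.tendsto 0
    rw [hg0] at this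
    exact this.mono_left nhdsWithin_le_nhds
  have hgpos : ∀ᶠ t in 𝓝[>] (0 : ℝ), 0 < g t := hgt.eventually (lt_mem_nhds one_pos)
  have hyL : ∀ᶠ t in 𝓝[>] (0 : ℝ), y t ∈ frontier L := by
    filter_upwards [hgpos] with t ht
    rw [← gauge_eq_one_iff_mem_frontier hL.convex hL.mem_nhds_zero, hy,
      gauge_smul_of_nonneg (inv_nonneg.2 ht.le), smul_eq_mul]
    exact inv_mul_cancel₀ ht.ne'
  have hline : Tendsto (fun t : ℝ => x + t • v) (𝓝[>] 0) (𝓝 x) := by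
    have : Tendsto (fun t : ℝ => x + t • v) (𝓝 0) (𝓝 (x + (0 : ℝ) • v)) :=
      Continuous.tendsto (by fun_prop) 0
    simpa using this.mono_left nhdsWithin_le_nhds
  have hyx : Tendsto y (𝓝[>] 0) (𝓝 x) := by
    have := (hgt.inv₀ one_ne_zero).smul hline
    rwa [inv_one, one_smul] at this
  have hN : Tendsto (fun t => gaussMap L (y t)) (𝓝[>] 0) (𝓝 (gaussMap L x)) :=
    (hL.continuousOn_gaussMap x hx).tendsto.comp (tendsto_nhdsWithin_iff.2 ⟨hyx, hyL⟩)
  -- The support inequality at `x` gives `g t ≥ 1`; the one at `y t` bounds `(g t - 1)/t` by a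
  -- quotient that tends to `⟪v, N(x)⟫/⟪x, N(x)⟫ = 0`, because the Gauss map is continuous.
  have hslope : Tendsto (fun t => t⁻¹ * (g t - 1)) (𝓝[>] 0) (𝓝 0) := by
    have hub : Tendsto (fun t => ⟪v, gaussMap L (y t)⟫ / ⟪y t, gaussMap L (y t)⟫) (𝓝[>] 0)
        (𝓝 0) := by
      have h1 := (tendsto_const_nhds (x := v)).inner hN (𝕜 := ℝ)
      have h2 := h1.div (hyx.inner hN (𝕜 := ℝ)) (hL.supp_pos hx).ne'
      rwa [hv, zero_div] at h2
    refine tendsto_of_tendsto_of_tendsto_of_le_of_le' tendsto_const_nhds hub ?_ ?_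
    · filter_upwards [hgpos, hyL, self_mem_nhdsWithin] with t ht hyt ht0
      have h1 := (hL.isOuterUnitNormal hx).2 _ (hL.frontier_subset hyt)
      have hs := hL.supp_pos hx
      rw [supp] at hs
      simp only [hy] at h1
      rw [inner_sub_left, real_inner_smul_left, inner_add_left, real_inner_smul_left, hv, mul_zero,
        add_zero] at h1
      have h2 : (g t)⁻¹ ≤ 1 := by
        by_contra hcon
        push Not at hcon
        nlinarith
      have h3 : 1 ≤ g t := (inv_le_one₀ ht).1 h2
      have : 0 < t := ht0
      have : 0 ≤ g t - 1 := sub_nonneg.2 h3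
      positivity
    · filter_upwards [hgpos, hyL, self_mem_nhdsWithin] with t ht hyt ht0
      have h1 := (hL.isOuterUnitNormal hyt).2 _ (hL.frontier_subset hx)
      have hs := hL.supp_pos hyt
      rw [supp] at hs
      have ht0' : (0 : ℝ) < t := ht0
      have h2 : g t • y t = x + t • v := smul_inv_smul₀ ht.ne' _
      have h3 : g t * ⟪y t, gaussMap L (y t)⟫ =
          ⟪x, gaussMap L (y t)⟫ + t * ⟪v, gaussMap L (y t)⟫ := by
        rw [← real_inner_smul_left, h2, inner_add_left, real_inner_smul_left]
      rw [inner_sub_left] at h1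
      rw [le_div_iff₀ hs, mul_assoc, inv_mul_le_iff₀ ht0']
      linarith
  refine ⟨fun t => y t - x, by simpa using hyx.sub_const x, by simpa using hyL, ?_⟩
  have h1 : Tendsto (fun t => (g t)⁻¹ • (v - (t⁻¹ * (g t - 1)) • x)) (𝓝[>] 0)
      (𝓝 ((1 : ℝ)⁻¹ • (v - (0 : ℝ) • x))) :=
    (hgt.inv₀ one_ne_zero).smul (tendsto_const_nhds.sub (hslope.smul_const x))
  rw [inv_one, one_smul, zero_smul, sub_zero] at h1
  refine h1.congr' ?_
  filter_upwards [hgpos, self_mem_nhdsWithin] with t ht ht0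
  have ht0' : t ≠ 0 := ne_of_gt ht0
  have ht' := ht.ne'
  simp only [hy]
  match_scalars <;> field_simp
  ring

/-- Derivatives within `∂L` are unique only along the tangent cone; this is what lets `fderivWithin`
in `weingarten` be replaced by the derivative of any chart. -/
theorem mem_tangentConeAt (hL : IsRegularBody L) (hx : x ∈ frontier L)
    (hv : ⟪v, gaussMap L x⟫ = 0) : v ∈ tangentConeAt ℝ (frontier L) x := by
  obtain ⟨d, h1, h2, h3⟩ := hL.exists_curve hx hv
  exact mem_tangentConeAt_of_seq (𝓝[>] (0 : ℝ)) (fun t => t⁻¹) d h1 h2 h3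

end IsRegularBody

namespace IsNormalChart

variable {L : Set (E n)} {x v : E n} {G : E n → E n}

theorem fderivWithin_gaussMap_apply (hG : IsNormalChart L x G) (hL : IsRegularBody L)
    (hx : x ∈ frontier L) (hv : ⟪v, gaussMap L x⟫ = 0) :
    fderivWithin ℝ (gaussMap L) (frontier L) x v = fderiv ℝ G x v :=
  have h := hG.hasFDerivWithinAt_gaussMap hL hx
  h.differentiableWithinAt.hasFDerivWithinAt.unique_on h (hL.mem_tangentConeAt hx hv)

/-- The Gauss map of a convex body is monotone: adding the support inequalities at two boundary
points gives `⟪N(y) - N(x), y - x⟫ ≥ 0`. Rescaling along a boundary curve and passing to the limit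
yields the claim. -/
theorem inner_fderiv_nonneg (hG : IsNormalChart L x G) (hL : IsRegularBody L)
    (hx : x ∈ frontier L) (hv : ⟪v, gaussMap L x⟫ = 0) : 0 ≤ ⟪fderiv ℝ G x v, v⟫ := by
  obtain ⟨d, h1, h2, h3⟩ := hL.exists_curve hx hv
  have h4 := (hG.hasFDerivWithinAt_gaussMap hL hx).lim h1 h2 h3
  refine ge_of_tendsto (h4.inner h3) ?_
  filter_upwards [h2, self_mem_nhdsWithin] with t ht ht0
  have ha := (hL.isOuterUnitNormal hx).2 _ (hL.frontier_subset ht)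
  have hb := (hL.isOuterUnitNormal ht).2 _ (hL.frontier_subset hx)
  rw [real_inner_smul_left, real_inner_smul_right, inner_sub_left]
  rw [add_sub_cancel_left, real_inner_comm] at ha
  rw [sub_add_cancel_left, inner_neg_left, real_inner_comm] at hb
  have : 0 < t := ht0
  have : 0 ≤ ⟪gaussMap L (x + d t), d t⟫ - ⟪gaussMap L x, d t⟫ := by linarith
  positivity

end IsNormalChart

/-! ### Elementary symmetric functions of eigenvalues as characteristic coefficients -/

section LinearAlgebra

theorem esymm_pos {s : Multiset ℝ} (hs : ∀ a ∈ s, 0 < a) {j : ℕ} (hj : j ≤ s.card) :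
    0 < s.esymm j := by
  rw [Multiset.esymm]
  have hpos : ∀ b ∈ (s.powersetCard j).map Multiset.prod, 0 < b := by
    intro b hb
    obtain ⟨t, ht, rfl⟩ := Multiset.mem_map.1 hb
    exact Multiset.prod_pos fun a ha =>
      hs a (Multiset.mem_of_le (Multiset.mem_powersetCard.1 ht).1 ha)
  have hne : (s.powersetCard j).map Multiset.prod ≠ 0 := by
    rw [Ne, ← Multiset.card_eq_zero, Multiset.card_map, Multiset.card_powersetCard]
    exact (Nat.choose_pos hj).ne'
  obtain ⟨b, hb⟩ := Multiset.exists_mem_of_ne_zero hne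
  obtain ⟨t, ht⟩ := Multiset.exists_cons_of_mem hb
  rw [ht, Multiset.sum_cons]
  refine add_pos_of_pos_of_nonneg (hpos b hb) (Multiset.sum_nonneg fun a ha => ?_)
  exact (hpos a (by rw [ht]; exact Multiset.mem_cons_of_mem ha)).le

/-- A symmetric operator is diagonalizable over `ℝ`, so its characteristic polynomial splits. -/
theorem card_roots_charpoly {V : Type*} [NormedAddCommGroup V] [InnerProductSpace ℝ V]
    [FiniteDimensional ℝ V] {T : V →ₗ[ℝ] V} (hT : T.IsSymmetric) :
    T.charpoly.roots.card = Module.finrank ℝ V := by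
  simp [hT.roots_charpoly_eq_eigenvalues rfl]

/-- The elementary symmetric functions of the eigenvalues of a symmetric operator are, up to sign,
the coefficients of the characteristic polynomial. -/
theorem esymm_roots_charpoly {V : Type*} [NormedAddCommGroup V] [InnerProductSpace ℝ V]
    [FiniteDimensional ℝ V] {T : V →ₗ[ℝ] V} (hT : T.IsSymmetric) {j : ℕ}
    (hj : j ≤ Module.finrank ℝ V) :
    T.charpoly.roots.esymm j = (-1) ^ j * T.charpoly.coeff (Module.finrank ℝ V - j) := by
  have hdeg := T.charpoly_natDegree
  rw [Polynomial.coeff_eq_esymm_roots_of_card (by rw [card_roots_charpoly hT, hdeg])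
    (by rw [hdeg]; omega), T.charpoly_monic.leadingCoeff, hdeg, Nat.sub_sub_self hj, one_mul,
    ← mul_assoc, ← mul_pow]
  simp

/-- The characteristic polynomials of `f ∘ g` and `g ∘ f` differ by a power of `X`. -/
theorem charpoly_comp_comm {V W : Type*} [AddCommGroup V] [Module ℝ V]
    [FiniteDimensional ℝ V] [AddCommGroup W] [Module ℝ W] [FiniteDimensional ℝ W]
    (f : V →ₗ[ℝ] W) (g : W →ₗ[ℝ] V) (h : Module.finrank ℝ V ≤ Module.finrank ℝ W) :
    (f ∘ₗ g).charpoly =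
      Polynomial.X ^ (Module.finrank ℝ W - Module.finrank ℝ V) * (g ∘ₗ f).charpoly := by
  let bV := Module.finBasis ℝ V
  let bW := Module.finBasis ℝ W
  rw [← LinearMap.charpoly_toMatrix _ bW, ← LinearMap.charpoly_toMatrix (g ∘ₗ f) bV,
    LinearMap.toMatrix_comp bW bV bW, LinearMap.toMatrix_comp bV bW bV,
    Matrix.charpoly_mul_comm_of_le _ _ (by simpa using h)]
  simp

/-- The coefficients of the characteristic polynomial depend continuously on the operator. -/
theorem continuous_charpoly_coeff (j : ℕ) :
    Continuous fun A : E n →L[ℝ] E n => (A : E n →ₗ[ℝ] E n).charpoly.coeff j := by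
  let b := (EuclideanSpace.basisFun (Fin n) ℝ).toBasis
  let M : (E n →L[ℝ] E n) → Fin n × Fin n → ℝ := fun A p =>
    LinearMap.toMatrix b b (A : E n →ₗ[ℝ] E n) p.1 p.2
  have hM : Continuous M := by
    refine continuous_pi fun p => ?_
    have : (fun A => M A p) = fun A : E n →L[ℝ] E n =>
        (A (EuclideanSpace.single p.2 1)) p.1 := by
      ext A
      simp [M, b, LinearMap.toMatrix_apply]
    rw [this]
    fun_prop
  -- Each coefficient is a universal polynomial evaluated at the matrix entries.
  have key : (fun A : E n →L[ℝ] E n => (A : E n →ₗ[ℝ] E n).charpoly.coeff j) = fun A =>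
      MvPolynomial.eval (M A) ((Matrix.charpoly.univ ℝ (Fin n)).coeff j) := by
    ext A
    rw [← LinearMap.charpoly_toMatrix _ b]
    have := Matrix.charpoly.univ_map_eval₂Hom (Fin n) (RingHom.id ℝ) (M A)
    have h2 : Matrix.of (Function.curry (M A)) =
      LinearMap.toMatrix b b (A : E n →ₗ[ℝ] E n) := rfl
    rw [← h2, ← this, Polynomial.coeff_map]
    rfl
  rw [key]
  exact (MvPolynomial.continuous_eval _).comp hM

end LinearAlgebra

/-! ### The Weingarten map and the sign of the principal curvatures -/

namespace IsRegularBody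

variable {L : Set (E n)} {x : E n}

theorem finrank_tangentSpace (hL : IsRegularBody L) (hx : x ∈ frontier L) :
    Module.finrank ℝ (tangentSpace L x) = n - 1 := by
  have h1 := (hL.isOuterUnitNormal hx).1
  have h0 : gaussMap L x ≠ 0 := by
    intro h; simp [h] at h1
  have h2 := Submodule.finrank_add_finrank_orthogonal (Submodule.span ℝ {gaussMap L x})
  rw [finrank_span_singleton h0, finrank_euclideanSpace_fin] at h2
  exact Nat.eq_sub_of_add_eq' h2

end IsRegularBody

namespace IsNormalChart

variable {L : Set (E n)} {x : E n} {G : E n → E n}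

theorem inner_of_mem_tangentSpace {L : Set (E n)} {x v : E n} (hv : v ∈ tangentSpace L x) :
    ⟪v, gaussMap L x⟫ = 0 :=
  Submodule.mem_orthogonal_singleton_iff_inner_left.1 hv

/-- Pairing with tangent vectors makes the projection in `weingarten` invisible, so tangency of the
derivative's values never has to be checked. -/
theorem inner_weingarten (hG : IsNormalChart L x G) (hL : IsRegularBody L)
    (hx : x ∈ frontier L) (v w : tangentSpace L x) :
    ⟪weingarten L x v, w⟫ = ⟪fderiv ℝ G x v, (w : E n)⟫ := by
  rw [← hG.fderivWithin_gaussMap_apply hL hx (inner_of_mem_tangentSpace v.2)]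
  simp only [weingarten, LinearMap.comp_apply]
  exact Submodule.inner_orthogonalProjectionOnto_eq_of_mem_right w _

theorem weingarten_isSymmetric (hG : IsNormalChart L x G) (hL : IsRegularBody L)
    (hx : x ∈ frontier L) : (weingarten L x).IsSymmetric := fun v w => by
  have hv := inner_of_mem_tangentSpace v.2
  have hw := inner_of_mem_tangentSpace w.2
  rw [hG.gaussMap_eq hL hx] at hv hw
  rw [hG.inner_weingarten hL hx, hG.symm v w hv hw, real_inner_comm, real_inner_comm _ v,
    hG.inner_weingarten hL hx]

theorem weingarten_eq_zero_iff (hG : IsNormalChart L x G) (hL : IsRegularBody L)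
    (hx : x ∈ frontier L) (v : tangentSpace L x) :
    weingarten L x v = 0 ↔ ∀ w, ⟪w, gaussMap L x⟫ = 0 → ⟪fderiv ℝ G x v, w⟫ = 0 := by
  constructor
  · intro h w hw
    have := hG.inner_weingarten hL hx v
      ⟨w, Submodule.mem_orthogonal_singleton_iff_inner_left.2 hw⟩
    rw [h, inner_zero_left] at this
    exact this.symm
  · intro h
    rw [← inner_self_eq_zero (𝕜 := ℝ), hG.inner_weingarten hL hx]
    exact h _ (inner_of_mem_tangentSpace (Subtype.property _))

theorem principalCurvatures_nonneg (hG : IsNormalChart L x G) (hL : IsRegularBody L)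
    (hx : x ∈ frontier L) {a : ℝ} (ha : a ∈ principalCurvatures L x) : 0 ≤ a := by
  obtain ⟨v, hv⟩ := ((Module.End.hasEigenvalue_iff_isRoot_charpoly (weingarten L x) a).2
    (Polynomial.isRoot_of_mem_roots ha)).exists_hasEigenvector
  have h1 := hG.inner_fderiv_nonneg hL hx (inner_of_mem_tangentSpace v.2)
  rw [← hG.inner_weingarten hL hx, hv.apply_eq_smul, real_inner_smul_left] at h1
  exact nonneg_of_mul_nonneg_left h1 (real_inner_self_pos.2 hv.2)

theorem card_principalCurvatures (hG : IsNormalChart L x G) (hL : IsRegularBody L)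
    (hx : x ∈ frontier L) : (principalCurvatures L x).card = n - 1 := by
  rw [principalCurvatures, card_roots_charpoly (hG.weingarten_isSymmetric hL hx),
    hL.finrank_tangentSpace hx]

theorem gaussCurv_eq_prod (hG : IsNormalChart L x G) (hL : IsRegularBody L)
    (hx : x ∈ frontier L) : gaussCurv L x = (principalCurvatures L x).prod := by
  rw [gaussCurv, symmCurv, Nat.choose_self, Nat.cast_one, inv_one, one_mul,
    ← hG.card_principalCurvatures hL hx, Multiset.esymm, Multiset.powersetCard_self]
  simp

/-- The curvatures are nonnegative by convexity, and their product is the Gauss curvature, so none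
can vanish. -/
theorem principalCurvatures_pos (hG : IsNormalChart L x G) (hL : IsRegularBody L)
    (hx : x ∈ frontier L) (hK : 0 < gaussCurv L x) {a : ℝ} (ha : a ∈ principalCurvatures L x) :
    0 < a := by
  refine lt_of_le_of_ne (hG.principalCurvatures_nonneg hL hx ha) ?_
  rintro rfl
  rw [hG.gaussCurv_eq_prod hL hx, Multiset.prod_eq_zero ha] at hK
  exact hK.false

theorem symmCurv_pos (hG : IsNormalChart L x G) (hL : IsRegularBody L)
    (hx : x ∈ frontier L) (hK : 0 < gaussCurv L x) {j : ℕ} (hj : j ≤ n - 1) :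
    0 < symmCurv L j x := by
  have : 0 < ((n - 1).choose j : ℝ) := by exact_mod_cast Nat.choose_pos hj
  exact mul_pos (inv_pos.2 this) (esymm_pos (fun a => hG.principalCurvatures_pos hL hx hK)
    (by rwa [hG.card_principalCurvatures hL hx]))

theorem zero_mem_principalCurvatures_iff :
    (0 : ℝ) ∈ principalCurvatures L x ↔ ∃ v, weingarten L x v = 0 ∧ v ≠ 0 := by
  rw [principalCurvatures, Polynomial.mem_roots (LinearMap.charpoly_monic _).ne_zero,
    ← Module.End.hasEigenvalue_iff_isRoot_charpoly]
  constructor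
  · intro h
    obtain ⟨v, hv⟩ := h.exists_hasEigenvector
    exact ⟨v, by simpa using hv.apply_eq_smul, hv.2⟩
  · rintro ⟨v, hv, h0⟩
    exact Module.End.hasEigenvalue_of_hasEigenvector
      (Module.End.hasEigenvector_iff.2 ⟨Module.End.mem_eigenspace_iff.2 (by simpa using hv), h0⟩)

/-- The Gauss curvature is positive exactly where the second fundamental form is nondegenerate. -/
theorem gaussCurv_pos_iff (hG : IsNormalChart L x G) (hL : IsRegularBody L)
    (hx : x ∈ frontier L) :
    0 < gaussCurv L x ↔ ∀ v, ⟪v, gaussMap L x⟫ = 0 →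
      (∀ w, ⟪w, gaussMap L x⟫ = 0 → ⟪fderiv ℝ G x v, w⟫ = 0) → v = 0 := by
  constructor
  · intro h v hv hvw
    by_contra hne
    have h0 : (0 : ℝ) ∈ principalCurvatures L x := by
      refine zero_mem_principalCurvatures_iff.2
        ⟨⟨v, Submodule.mem_orthogonal_singleton_iff_inner_left.2 hv⟩, ?_, ?_⟩
      · exact (hG.weingarten_eq_zero_iff hL hx _).2 hvw
      · simpa using hne
    exact (hG.principalCurvatures_pos hL hx h h0).false
  · intro h
    rw [hG.gaussCurv_eq_prod hL hx]
    refine Multiset.prod_pos fun a ha => ?_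
    refine lt_of_le_of_ne (hG.principalCurvatures_nonneg hL hx ha) ?_
    rintro rfl
    obtain ⟨v, hv, h0⟩ := zero_mem_principalCurvatures_iff.1 ha
    exact h0 (Subtype.ext (h v (inner_of_mem_tangentSpace v.2)
      ((hG.weingarten_eq_zero_iff hL hx v).1 hv)))

end IsNormalChart

/-! ### Continuity of the curvature functions on the boundary -/

section Continuity

variable {L : Set (E n)} {x : E n} {G : E n → E n}

/-- The coordinate expression of the orthogonal projection onto the hyperplane `uᗮ`, for a unit
vector `u`. -/
theorem orthogonalProjectionOnto_unit_orthogonal {u : E n} (hu : ‖u‖ = 1) (z : E n) :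
    ((Submodule.span ℝ {u})ᗮ.orthogonalProjectionOnto z : E n) = z - ⟪u, z⟫ • u := by
  rw [Submodule.coe_orthogonalProjectionOnto_apply, Submodule.starProjection_orthogonal_val,
    Submodule.starProjection_unit_singleton ℝ hu]

theorem IsNormalChart.eventually_fderivWithin_gaussMap_apply (hG : IsNormalChart L x G)
    (hL : IsRegularBody L) :
    ∀ᶠ y in 𝓝[frontier L] x, ∀ v, ⟪v, gaussMap L y⟫ = 0 →
      fderivWithin ℝ (gaussMap L) (frontier L) y v = fderiv ℝ G y v := by
  have h1 := eventually_eventually_nhdsWithin.2 (hG.gaussMap_eventuallyEq hL)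
  have h2 := (hG.contDiffAt.eventually (by simp)).filter_mono (nhdsWithin_le_nhds (s := frontier L))
  filter_upwards [h1, h2, self_mem_nhdsWithin] with y hy1 hy2 hyL v hv
  have h3 : HasFDerivWithinAt (gaussMap L) (fderiv ℝ G y) (frontier L) y :=
    (hy2.differentiableAt (by norm_num)).hasFDerivAt.hasFDerivWithinAt.congr_of_eventuallyEq
      hy1 (hy1.self_of_nhdsWithin hyL)
  exact h3.differentiableWithinAt.hasFDerivWithinAt.unique_on h3 (hL.mem_tangentConeAt hyL hv)

/-- The orthogonal projection along `u`, as a continuous linear map depending continuously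
on `u`. -/
noncomputable def projAlong (u : E n) : E n →L[ℝ] E n :=
  ContinuousLinearMap.id ℝ (E n) - (innerSL ℝ u).smulRight u

theorem continuous_projAlong : Continuous (projAlong (n := n)) := by
  have h : Continuous fun u : E n => (innerSL ℝ u).smulRight u :=
    ((ContinuousLinearMap.smulRightL ℝ (E n) (E n)).continuous₂).comp
      ((innerSL ℝ).continuous.prodMk continuous_id)
  exact continuous_const.sub h

/-- The Weingarten map acts on a space that moves with `x`; to compare different points, it is
replaced by an endomorphism of `ℝⁿ`. It is `g ∘ f` where `A ∘ projAlong` is `f ∘ g`, and the extra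
factor `X ^ (n - (n - 1))` shifts the index of the coefficient. -/
theorem IsRegularBody.symmCurv_eq_coeff (hL : IsRegularBody L) (hx : x ∈ frontier L) {j : ℕ}
    (hj : j ≤ n - 1) {A : E n →L[ℝ] E n}
    (hA : ∀ v, ⟪v, gaussMap L x⟫ = 0 → fderivWithin ℝ (gaussMap L) (frontier L) x v = A v) :
    symmCurv L j x = ((n - 1).choose j : ℝ)⁻¹ * ((-1) ^ j *
      ((A ∘L projAlong (gaussMap L x) : E n →L[ℝ] E n) : E n →ₗ[ℝ] E n).charpoly.coeff
        (n - 1 - j + (n - (n - 1)))) := by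
  obtain ⟨G, hG⟩ := hL.exists_chart x hx
  have hfin := hL.finrank_tangentSpace hx
  have hu := (hL.isOuterUnitNormal hx).1
  rw [symmCurv, principalCurvatures,
    esymm_roots_charpoly (hG.weingarten_isSymmetric hL hx) (by rwa [hfin]), hfin]
  congr 2
  have hcomp : ((A ∘L projAlong (gaussMap L x) : E n →L[ℝ] E n) : E n →ₗ[ℝ] E n) =
      ((fderivWithin ℝ (gaussMap L) (frontier L) x).toLinearMap ∘ₗ (tangentSpace L x).subtype) ∘ₗ
        (tangentSpace L x).orthogonalProjectionOnto.toLinearMap := by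
    ext1 z
    have h1 : projAlong (gaussMap L x) z =
        ((tangentSpace L x).orthogonalProjectionOnto z : E n) := by
      rw [orthogonalProjectionOnto_unit_orthogonal hu]
      simp [projAlong]
    have h2 := hA ((tangentSpace L x).orthogonalProjectionOnto z : E n)
      (IsNormalChart.inner_of_mem_tangentSpace (Subtype.property _))
    change A (projAlong (gaussMap L x) z) = _
    rw [h1, ← h2]
    rfl
  rw [hcomp, charpoly_comp_comm _ _ (by rw [hfin, finrank_euclideanSpace_fin]; omega),
    hfin, finrank_euclideanSpace_fin, Polynomial.coeff_X_pow_mul]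
  rfl

theorem IsRegularBody.continuousOn_symmCurv (hL : IsRegularBody L) {j : ℕ} (hj : j ≤ n - 1) :
    ContinuousOn (symmCurv L j) (frontier L) := fun x hx => by
  obtain ⟨G, hG⟩ := hL.exists_chart x hx
  have hev := hG.eventually_fderivWithin_gaussMap_apply hL
  have hB : ContinuousWithinAt (fun y => (fderiv ℝ G y) ∘L projAlong (gaussMap L y))
      (frontier L) x :=
    (hG.contDiffAt.continuousAt_fderiv (by norm_num)).continuousWithinAt.clm_comp
      (continuous_projAlong.continuousAt.comp_continuousWithinAt
        (hG.continuousWithinAt_gaussMap hL hx))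
  refine ContinuousWithinAt.congr_of_eventuallyEq_of_mem (f := fun y =>
    ((n - 1).choose j : ℝ)⁻¹ * ((-1) ^ j *
      (((fderiv ℝ G y) ∘L projAlong (gaussMap L y) : E n →L[ℝ] E n) :
        E n →ₗ[ℝ] E n).charpoly.coeff (n - 1 - j + (n - (n - 1))))) ?_ ?_ hx
  · exact continuousWithinAt_const.mul (continuousWithinAt_const.mul
      ((continuous_charpoly_coeff _).continuousAt.comp_continuousWithinAt hB))
  · filter_upwards [hev, self_mem_nhdsWithin] with y hy hyL
    exact hL.symmCurv_eq_coeff hyL hj hy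

theorem IsRegularBody.continuousOn_supp (hL : IsRegularBody L) :
    ContinuousOn (supp L) (frontier L) :=
  continuousOn_id.inner hL.continuousOn_gaussMap

end Continuity

/-! ### The surface measure is finite and nonzero -/

section SurfaceMeasure

variable {L : Set (E n)} {x : E n}

/-- The line is connected and leaves the bounded set `L`, so it cannot be covered by the interior
and the complement. -/
theorem IsRegularBody.exists_add_smul_mem_frontier (hL : IsRegularBody L) {z e : E n}
    (hz : z ∈ L) (he : e ≠ 0) : ∃ t : ℝ, z + t • e ∈ frontier L := by
  obtain ⟨R, hR⟩ := hL.isCompact.isBounded.exists_norm_le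
  have hconn : IsPreconnected (Set.range fun t : ℝ => z + t • e) :=
    isPreconnected_range (by fun_prop)
  have hout : ∃ t : ℝ, z + t • e ∉ L := by
    refine ⟨(R + ‖z‖ + 1) / ‖e‖, fun h => ?_⟩
    have hR0 : 0 ≤ R := (norm_nonneg z).trans (hR z hz)
    have h1 := hR _ h
    have h2 : ‖((R + ‖z‖ + 1) / ‖e‖) • e‖ = R + ‖z‖ + 1 := by
      rw [norm_smul, Real.norm_of_nonneg (by positivity),
        div_mul_cancel₀ _ (norm_ne_zero_iff.2 he)]
    have h3 := norm_sub_le (z + ((R + ‖z‖ + 1) / ‖e‖) • e) z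
    rw [add_sub_cancel_left, h2] at h3
    linarith
  obtain ⟨t, ht⟩ := hout
  by_contra! hcon
  have hsub : (Set.range fun t : ℝ => z + t • e) ⊆ interior L ∪ Lᶜ := by
    rintro _ ⟨s, rfl⟩
    by_cases hs : z + s • e ∈ L
    · left
      by_contra hi
      exact hcon s ⟨subset_closure hs, hi⟩
    · exact Or.inr hs
  have hz' : z ∈ Set.range fun t : ℝ => z + t • e := ⟨0, by simp⟩
  have h0 : z ∈ interior L := by
    rcases hsub hz' with h | h
    · exact h
    · exact absurd hz h
  obtain ⟨y, -, hy⟩ := hconn _ _ isOpen_interior hL.isCompact.isClosed.isOpen_compl hsub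
    ⟨z, hz', h0⟩ ⟨z + t • e, ⟨t, rfl⟩, ht⟩
  exact hy.2 (interior_subset hy.1)

theorem IsRegularBody.frontier_nonempty (hL : IsRegularBody L) (hn : 1 ≤ n) :
    (frontier L).Nonempty := by
  have he : (EuclideanSpace.single (⟨0, hn⟩ : Fin n) (1 : ℝ)) ≠ 0 := by simp
  obtain ⟨t, ht⟩ := hL.exists_add_smul_mem_frontier (interior_subset hL.zero_mem) he
  exact ⟨_, ht⟩

/-- Near a boundary point, the orthogonal projection to the tangent space is bi-Lipschitz. -/
theorem IsRegularBody.exists_nhdsWithin_antilipschitz (hL : IsRegularBody L)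
    (hx : x ∈ frontier L) : ∃ S ∈ 𝓝[frontier L] x, S ⊆ frontier L ∧ ∀ y ∈ S, ∀ z ∈ S,
      ‖y - z‖ ≤ 2 * ‖(tangentSpace L x).orthogonalProjectionOnto (y - z)‖ := by
  have hu := (hL.isOuterUnitNormal hx).1
  have hS : {y | dist (gaussMap L y) (gaussMap L x) < 1 / 2} ∈ 𝓝[frontier L] x :=
    (hL.continuousOn_gaussMap x hx) (Metric.ball_mem_nhds _ (by norm_num))
  refine ⟨_, inter_mem hS self_mem_nhdsWithin, Set.inter_subset_right, ?_⟩
  -- Replacing `N(x)` by `N(y)` costs at most half of `‖y - z‖`, and `⟪N(y), z - y⟫ ≤ 0`. Used in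
  -- both orders, this bounds the normal component of `y - z` by half its norm, whence the constant
  -- `2`.
  have key : ∀ y ∈ frontier L, ∀ z ∈ frontier L, dist (gaussMap L y) (gaussMap L x) < 1 / 2 →
      ⟪gaussMap L x, z - y⟫ ≤ 1 / 2 * ‖y - z‖ := by
    intro y hy z hz hd
    have h1 := (hL.isOuterUnitNormal hy).2 z (hL.frontier_subset hz)
    have h2 := real_inner_le_norm (gaussMap L x - gaussMap L y) (z - y)
    rw [dist_comm, dist_eq_norm] at hd
    rw [inner_sub_left, real_inner_comm (z - y) (gaussMap L y), norm_sub_rev z y] at h2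
    nlinarith [norm_nonneg (y - z)]
  rintro y ⟨hyd, hy⟩ z ⟨hzd, hz⟩
  have h1 := key y hy z hz hyd
  have h2 := key z hz y hy hzd
  rw [norm_sub_rev z y] at h2
  rw [← neg_sub, inner_neg_right] at h1
  set w := y - z
  set P := (tangentSpace L x).orthogonalProjectionOnto w with hP
  have h3 : (P : E n) = w - ⟪gaussMap L x, w⟫ • gaussMap L x :=
    orthogonalProjectionOnto_unit_orthogonal hu w
  have h4 : ‖w‖ ≤ ‖P‖ + 1 / 2 * ‖w‖ := by
    calc ‖w‖ = ‖(P : E n) + ⟪gaussMap L x, w⟫ • gaussMap L x‖ := by rw [h3, sub_add_cancel]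
      _ ≤ ‖(P : E n)‖ + ‖⟪gaussMap L x, w⟫ • gaussMap L x‖ := norm_add_le _ _
      _ ≤ ‖P‖ + 1 / 2 * ‖w‖ := by
        rw [norm_smul, hu, mul_one, Real.norm_eq_abs, Submodule.coe_norm]
        gcongr
        exact abs_le.2 ⟨by linarith, h2⟩
  linarith

/-- By compactness the claim is local. There the tangential projection is antilipschitz, and its
image lies in a compact subset of the tangent space, on which Hausdorff measure is a Haar measure.
-/
theorem IsRegularBody.hausdorffMeasure_frontier_lt_top (hL : IsRegularBody L) :
    μH[((n - 1 : ℕ) : ℝ)] (frontier L) < ⊤ := by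
  refine hL.isCompact_frontier.measure_lt_top_of_nhdsWithin fun x hx => ?_
  obtain ⟨S, hS, hSL, hanti⟩ := hL.exists_nhdsWithin_antilipschitz hx
  refine ⟨S, hS, ?_⟩
  let T := tangentSpace L x
  let f : S → T := fun y => T.orthogonalProjectionOnto y
  have hf : AntilipschitzWith 2 f := AntilipschitzWith.of_le_mul_dist fun y z => by
    rw [Subtype.dist_eq, dist_eq_norm, dist_eq_norm, ← map_sub]
    exact hanti y y.2 z z.2
  have hhaar : (μH[((n - 1 : ℕ) : ℝ)] : Measure T).IsAddHaarMeasure := by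
    rw [← hL.finrank_tangentSpace hx]
    exact isAddHaarMeasure_hausdorffMeasure
  have h1 := hf.le_hausdorffMeasure_image (d := ((n - 1 : ℕ) : ℝ)) (by positivity) Set.univ
  have h2 : μH[((n - 1 : ℕ) : ℝ)] S = μH[((n - 1 : ℕ) : ℝ)] (Set.univ : Set S) := by
    have hiso : Isometry (Subtype.val : S → E n) := isometry_subtype_coe
    rw [← hiso.hausdorffMeasure_image (Or.inl (by positivity)), Set.image_univ,
      Subtype.range_coe]
  rw [h2]
  refine h1.trans_lt (ENNReal.mul_lt_top (by simp) ?_)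
  have h3 : f '' Set.univ ⊆ T.orthogonalProjectionOnto '' L := by
    rintro _ ⟨y, -, rfl⟩
    exact ⟨y, hL.frontier_subset (hSL y.2), rfl⟩
  exact (measure_mono h3).trans_lt
    (hL.isCompact.image T.orthogonalProjectionOnto.continuous).measure_lt_top

/-- Orthogonal projection does not increase Hausdorff measure, and the projection of `∂L` along one
of its normals contains a ball: every normal line through a point of `L` meets `∂L`. -/
theorem IsRegularBody.hausdorffMeasure_frontier_pos (hL : IsRegularBody L) (hn : 1 ≤ n) :
    0 < μH[((n - 1 : ℕ) : ℝ)] (frontier L) := by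
  obtain ⟨x, hx⟩ := hL.frontier_nonempty hn
  have hu := (hL.isOuterUnitNormal hx).1
  have hu0 : gaussMap L x ≠ 0 := by
    intro h; simp [h] at hu
  let T := tangentSpace L x
  have hhaar : (μH[((n - 1 : ℕ) : ℝ)] : Measure T).IsAddHaarMeasure := by
    rw [← hL.finrank_tangentSpace hx]
    exact isAddHaarMeasure_hausdorffMeasure
  obtain ⟨r, hr, hrL⟩ := Metric.mem_nhds_iff.1 hL.mem_nhds_zero
  refine lt_of_lt_of_le (Metric.measure_ball_pos μH[((n - 1 : ℕ) : ℝ)] (0 : T) hr)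
    ((measure_mono ?_).trans (hausdorffMeasure_orthogonalProjectionOnto_le T _ (frontier L)
      (by positivity)))
  intro w hw
  have hwL : (w : E n) ∈ L := hrL (by simpa using hw)
  obtain ⟨t, ht⟩ := hL.exists_add_smul_mem_frontier hwL hu0
  refine ⟨_, ht, ?_⟩
  rw [map_add, map_smul, Submodule.orthogonalProjectionOnto_mem_subspace_eq_self]
  have : T.orthogonalProjectionOnto (gaussMap L x) = 0 := by
    apply Subtype.ext
    rw [orthogonalProjectionOnto_unit_orthogonal hu, real_inner_self_eq_norm_sq, hu]
    simp
  rw [this, smul_zero, add_zero]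

theorem IsRegularBody.euclideanHausdorffMeasure_frontier_lt_top (hL : IsRegularBody L) :
    (μHE[n - 1] : Measure (E n)) (frontier L) < ⊤ := by
  rw [Measure.euclideanHausdorffMeasure_def, Measure.smul_apply, ENNReal.smul_def, smul_eq_mul]
  exact ENNReal.mul_lt_top ENNReal.coe_lt_top hL.hausdorffMeasure_frontier_lt_top

theorem IsRegularBody.euclideanHausdorffMeasure_frontier_pos (hL : IsRegularBody L)
    (hn : 1 ≤ n) : 0 < (μHE[n - 1] : Measure (E n)) (frontier L) := by
  rw [Measure.euclideanHausdorffMeasure_def, Measure.smul_apply, ENNReal.smul_def, smul_eq_mul]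
  exact ENNReal.mul_pos
    (by simpa using Measure.addHaarScalarFactor_volume_hausdorffMeasure_ne_zero (n - 1))
    (hL.hausdorffMeasure_frontier_pos hn).ne'

end SurfaceMeasure

/-! ### Uniform bounds for the weighted measure and the densities -/

section WeightMeasure

variable {m k : ℕ} {i : ℕ → ℕ} {L : Set (E n)}

theorem weightMeasure_absolutelyContinuous :
    weightMeasure m k i L ≪ (μHE[n - 1] : Measure (E n)).restrict (frontier L) :=
  withDensity_absolutelyContinuous _ _

theorem IsRegularBody.aePosBounded (hL : IsRegularBody L) {f : E n → ℝ}
    (hf : ContinuousOn f (frontier L)) (hpos : ∀ x ∈ frontier L, 0 < f x) :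
    AEPosBounded ((μHE[n - 1] : Measure (E n)).restrict (frontier L)) f := by
  have hm : MeasurableSet (frontier L) := isClosed_frontier.measurableSet
  refine ⟨hf.aestronglyMeasurable hm, ?_⟩
  rcases (frontier L).eq_empty_or_nonempty with h | h
  · exact ⟨1, 1, one_pos, by simp [h]⟩
  obtain ⟨a, ha, hamin⟩ := hL.isCompact_frontier.exists_isMinOn h hf
  obtain ⟨b, hb, hbmax⟩ := hL.isCompact_frontier.exists_isMaxOn h hf
  exact ⟨f a, f b, hpos a ha, ae_restrict_of_forall_mem hm fun x hx => ⟨hamin hx, hbmax hx⟩⟩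

theorem AEPosBounded.mono_ac {X : Type*} [MeasurableSpace X] {μ ν : Measure X} {f : X → ℝ}
    (hf : AEPosBounded μ f) (h : ν ≪ μ) : AEPosBounded ν f := by
  obtain ⟨hm, c, C, hc, hf⟩ := hf
  exact ⟨hm.mono_ac h, c, C, hc, h.ae_le hf⟩

theorem IsRegularBody.gaussCurv_aePosBounded (hL : IsRegularBody L)
    (hK : ∀ x ∈ frontier L, 0 < gaussCurv L x) :
    AEPosBounded (weightMeasure m k i L) (gaussCurv L) :=
  (hL.aePosBounded (hL.continuousOn_symmCurv le_rfl) hK).mono_ac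
    weightMeasure_absolutelyContinuous

theorem IsRegularBody.supp_aePosBounded (hL : IsRegularBody L) :
    AEPosBounded (weightMeasure m k i L) (supp L) :=
  (hL.aePosBounded hL.continuousOn_supp fun _ hx => hL.supp_pos hx).mono_ac
    weightMeasure_absolutelyContinuous

/-- The upper bound makes the weighted measure finite; positivity makes it nonzero, as
`ENNReal.ofReal` then truncates nothing. -/
theorem IsRegularBody.weight_aePosBounded (hL : IsRegularBody L)
    (hK : ∀ x ∈ frontier L, 0 < gaussCurv L x) :
    AEPosBounded ((μHE[n - 1] : Measure (E n)).restrict (frontier L)) fun x =>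
      (∏ j ∈ Finset.Icc 1 (n - 1), ((n - 1).choose j : ℝ) ^ i j) *
        supp L x ^ ((m : ℤ) - (k : ℤ)) * ∏ j ∈ Finset.Icc 1 (n - 1), symmCurv L j x ^ i j := by
  refine hL.aePosBounded ?_ fun x hx => ?_
  · refine (continuousOn_const.mul ?_).mul ?_
    · exact hL.continuousOn_supp.zpow₀ _ fun x hx => Or.inl (hL.supp_pos hx).ne'
    · exact continuousOn_finsetProd _ fun j hj =>
        (hL.continuousOn_symmCurv (Finset.mem_Icc.1 hj).2).pow _
  · obtain ⟨G, hG⟩ := hL.exists_chart x hx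
    refine mul_pos (mul_pos (Finset.prod_pos fun j hj => pow_pos ?_ _)
      (zpow_pos (hL.supp_pos hx) _)) (Finset.prod_pos fun j hj => pow_pos ?_ _)
    · exact_mod_cast Nat.choose_pos (Finset.mem_Icc.1 hj).2
    · exact hG.symmCurv_pos hL hx (hK x hx) (Finset.mem_Icc.1 hj).2

theorem IsRegularBody.isFiniteMeasure_weightMeasure (hL : IsRegularBody L)
    (hK : ∀ x ∈ frontier L, 0 < gaussCurv L x) : IsFiniteMeasure (weightMeasure m k i L) := by
  have : IsFiniteMeasure ((μHE[n - 1] : Measure (E n)).restrict (frontier L)) :=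
    ⟨by simpa using hL.euclideanHausdorffMeasure_frontier_lt_top⟩
  exact isFiniteMeasure_withDensity_ofReal (hL.weight_aePosBounded hK).integrable.2

theorem IsRegularBody.neZero_weightMeasure (hL : IsRegularBody L) (hn : 1 ≤ n)
    (hK : ∀ x ∈ frontier L, 0 < gaussCurv L x) : NeZero (weightMeasure m k i L) := by
  constructor
  intro h0
  have hw := hL.weight_aePosBounded hK (m := m) (k := k) (i := i)
  have h1 := withDensity_eq_zero hw.1.aemeasurable.ennreal_ofReal h0
  have h2 : ∀ᵐ _ ∂((μHE[n - 1] : Measure (E n)).restrict (frontier L)), False := by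
    filter_upwards [h1, hw.pos] with x hx hpos
    exact (ENNReal.ofReal_pos.2 hpos).ne' hx
  rw [eventually_false_iff_eq_bot, ae_eq_bot, Measure.restrict_eq_zero] at h2
  exact (hL.euclideanHausdorffMeasure_frontier_pos hn).ne' h2

end WeightMeasure

/-! ### The centroid is an interior point -/

section Centroid

/-- A convex body contains its centroid in the interior. -/
theorem zero_mem_interior_of_centroid {K : Set (E n)} (hK : IsConvexBody K)
    (h : (volume.real K)⁻¹ • (∫ x in K, x) = 0) : (0 : E n) ∈ interior K := by
  obtain ⟨hc, hcomp, hi⟩ := hK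
  have hvol : 0 < volume.real K := by
    rw [measureReal_def]
    refine ENNReal.toReal_pos ?_ hcomp.measure_lt_top.ne
    exact ((isOpen_interior.measure_pos volume hi).trans_le (measure_mono interior_subset)).ne'
  have hint : ∫ x in K, x = 0 := (smul_eq_zero.1 h).resolve_left (inv_ne_zero hvol.ne')
  by_contra h0
  -- A functional separating `0` from the interior is strictly negative there, yet its integral over
  -- `K` is its value at `∫ x = 0`; the frontier is a null set.
  obtain ⟨f, hf⟩ := geometric_hahn_banach_open_point hc.interior isOpen_interior h0
  rw [map_zero] at hf
  have hid : IntegrableOn (fun x : E n => x) K := continuousOn_id.integrableOn_compact hcomp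
  have hid' : IntegrableOn (fun x : E n => x) (interior K) := hid.mono_set interior_subset
  have hae : interior K =ᵐ[volume] K := interior_ae_eq_of_null_frontier (hc.addHaar_frontier volume)
  have h1 : ∫ x in interior K, f x = 0 := by
    rw [setIntegral_congr_set hae, ContinuousLinearMap.integral_comp_comm f hid, hint, map_zero]
  have h2 : 0 < ∫ x in interior K, -f x := by
    rw [setIntegral_pos_iff_support_of_nonneg_ae]
    · refine (isOpen_interior.measure_pos volume hi).trans_le (measure_mono fun x hx => ?_)
      exact ⟨by simpa using (hf x hx).ne, hx⟩
    · exact ae_restrict_of_forall_mem isOpen_interior.measurableSet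
        fun x hx => by simpa using (hf x hx).le
    · exact (f.integrable_comp hid').neg
  rw [integral_neg, h1, neg_zero] at h2
  exact h2.false

end Centroid

/-! ### Normal charts from `C²` defining functions -/

section DefiningFunction

variable {K : Set (E n)} {x y u : E n} {φ : E n → ℝ}

/-- The outward unit normal is the normalized gradient of a defining function. -/
theorem IsOuterUnitNormal.eq_normalize_gradient (hu : IsOuterUnitNormal K y u)
    (hd : DifferentiableAt ℝ φ y) (hφ0 : φ y = 0) (hg : gradient φ y ≠ 0)
    (hφ : ∀ᶠ z in 𝓝 y, (z ∈ K ↔ φ z ≤ 0)) :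
    u = ‖gradient φ y‖⁻¹ • gradient φ y := by
  set g := gradient φ y with hgdef
  -- A direction of strict decrease of `φ` enters `K`. So the half-space `⟪g, ·⟫ < 0` lies in `⟪·,
  -- u⟫ ≤ 0`, which forces `u` to be a nonnegative multiple of `g`.
  have hdir : ∀ v, ⟪g, v⟫ < 0 → ⟪v, u⟫ ≤ 0 := by
    intro v hv
    have hline : HasDerivAt (fun t : ℝ => φ (y + t • v)) ⟪g, v⟫ 0 := by
      have h1 : HasDerivAt (fun t : ℝ => y + t • v) v 0 := by
        simpa using ((hasDerivAt_id (0 : ℝ)).smul_const v).const_add y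
      have h2 : HasFDerivAt φ (fderiv ℝ φ y) (y + (0 : ℝ) • v) := by
        simpa using hd.hasFDerivAt
      have h3 := h2.comp_hasDerivAt (0 : ℝ) h1
      rwa [show fderiv ℝ φ y v = ⟪g, v⟫ by
        rw [hgdef, gradient, InnerProductSpace.toDual_symm_apply]] at h3
    have hneg : ∀ᶠ t in 𝓝[>] (0 : ℝ), t⁻¹ * φ (y + t • v) < 0 := by
      have := hline.tendsto_slope_zero_right
      simp only [zero_add, zero_smul, add_zero, hφ0, sub_zero, smul_eq_mul] at this
      exact this.eventually (gt_mem_nhds hv)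
    have hnear : ∀ᶠ t in 𝓝[>] (0 : ℝ), (y + t • v ∈ K ↔ φ (y + t • v) ≤ 0) := by
      have : Tendsto (fun t : ℝ => y + t • v) (𝓝[>] 0) (𝓝 y) := by
        have : Tendsto (fun t : ℝ => y + t • v) (𝓝 0) (𝓝 (y + (0 : ℝ) • v)) :=
          Continuous.tendsto (by fun_prop) 0
        simpa using this.mono_left nhdsWithin_le_nhds
      exact this.eventually hφ
    obtain ⟨t, h1, h2, h3⟩ := (hneg.and (hnear.and self_mem_nhdsWithin)).exists
    have ht : 0 < t := h3
    have h4 : φ (y + t • v) ≤ 0 := by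
      by_contra! hcon
      have : 0 < t⁻¹ * φ (y + t • v) := by positivity
      linarith
    have h5 := hu.2 _ (h2.2 h4)
    rw [add_sub_cancel_left, real_inner_smul_left] at h5
    by_contra! hcon
    have : 0 < t * ⟪v, u⟫ := by positivity
    linarith
  have hgg : 0 < ⟪g, g⟫ := real_inner_self_pos.2 hg
  have hperp : ∀ w, ⟪g, w⟫ = 0 → ⟪w, u⟫ ≤ 0 := by
    intro w hw
    by_contra! hcon
    -- The coefficient of `w` makes the pairing of this vector with `u` equal to `1`.
    have h1 := hdir (-g + ((⟪g, u⟫ + 1) / ⟪w, u⟫) • w) (by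
      rw [inner_add_right, inner_neg_right, real_inner_smul_right, hw, mul_zero, add_zero]
      linarith)
    rw [inner_add_left, inner_neg_left, real_inner_smul_left, div_mul_cancel₀ _ hcon.ne'] at h1
    linarith
  have hdecomp : u = (⟪g, u⟫ / ⟪g, g⟫) • g := by
    set w := u - (⟪g, u⟫ / ⟪g, g⟫) • g with hw
    have hgw : ⟪g, w⟫ = 0 := by
      rw [hw, inner_sub_right, real_inner_smul_right, div_mul_cancel₀ _ hgg.ne', sub_self]
    have h1 := hperp w hgw
    have h2 : ⟪w, u⟫ = ⟪w, w⟫ := by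
      have h3 : ⟪w, w⟫ = ⟪w, u⟫ - (⟪g, u⟫ / ⟪g, g⟫) * ⟪w, g⟫ := by
        rw [← real_inner_smul_right, ← inner_sub_right]
      rw [h3, real_inner_comm g w, hgw, mul_zero, sub_zero]
    rw [h2] at h1
    exact sub_eq_zero.1 (real_inner_self_nonpos.1 h1)
  have hgu : 0 ≤ ⟪g, u⟫ := by
    have := hdir (-g) (by rw [inner_neg_right]; linarith)
    rw [inner_neg_left] at this
    linarith
  have hnorm : ⟪g, u⟫ / ⟪g, g⟫ * ‖g‖ = 1 := by
    have := hu.1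
    rwa [hdecomp, norm_smul, Real.norm_of_nonneg (by positivity)] at this
  rw [hdecomp, ← eq_inv_of_mul_eq_one_left hnorm]

theorem eq_zero_of_mem_frontier (hc : ContinuousAt φ y) (hφ : ∀ᶠ z in 𝓝 y, (z ∈ K ↔ φ z ≤ 0))
    (hK : IsClosed K) (hy : y ∈ frontier K) : φ y = 0 := by
  have h1 : φ y ≤ 0 := hφ.self_of_nhds.1 (hK.frontier_subset hy)
  refine le_antisymm h1 ?_
  by_contra! hneg
  refine hy.2 (mem_interior_iff_mem_nhds.2 ?_)
  filter_upwards [hφ, hc.eventually (gt_mem_nhds hneg)] with z hz hz'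
  exact hz.2 hz'.le

theorem inner_gradient (v : E n) : ⟪gradient φ x, v⟫ = fderiv ℝ φ x v := by
  rw [gradient, InnerProductSpace.toDual_symm_apply]

theorem contDiffAt_gradient (hφ : ContDiffAt ℝ 2 φ x) : ContDiffAt ℝ 1 (gradient φ) x :=
  ((InnerProductSpace.toDual ℝ (E n)).symm.contDiff.contDiffAt).comp x
    (hφ.fderiv_right (by norm_num))

theorem inner_fderiv_gradient_symm (hφ : ContDiffAt ℝ 2 φ x) (v w : E n) :
    ⟪fderiv ℝ (gradient φ) x v, w⟫ = ⟪v, fderiv ℝ (gradient φ) x w⟫ := by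
  have hs : IsSymmSndFDerivAt ℝ φ x := hφ.isSymmSndFDerivAt (by simp)
  have hd : DifferentiableAt ℝ (fderiv ℝ φ) x :=
    (hφ.fderiv_right (m := 1) (by norm_num)).differentiableAt (by norm_num)
  have key : ∀ a b, ⟪fderiv ℝ (gradient φ) x a, b⟫ = fderiv ℝ (fderiv ℝ φ) x a b := by
    intro a b
    have h1 := (innerSL ℝ b).hasFDerivAt.comp x
      ((contDiffAt_gradient hφ).differentiableAt (by norm_num)).hasFDerivAt
    have h2 := (ContinuousLinearMap.apply ℝ ℝ b).hasFDerivAt.comp x hd.hasFDerivAt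
    have h3 : (innerSL ℝ b) ∘ gradient φ = (ContinuousLinearMap.apply ℝ ℝ b) ∘ fderiv ℝ φ := by
      ext z
      exact (real_inner_comm _ _).trans (inner_gradient b)
    rw [h3] at h1
    have h4 := DFunLike.congr_fun (h1.unique h2) a
    rw [real_inner_comm]
    simpa using h4
  rw [key, real_inner_comm, key]
  exact hs v w

/-- The normalized gradient of a `C²` defining function is a chart for the Gauss map. -/
theorem isNormalChart_normalize_gradient (hK : IsClosed K)
    (hφ2 : ContDiffAt ℝ 2 φ x) (hd : fderiv ℝ φ x ≠ 0)
    (hφ : ∀ᶠ z in 𝓝 x, (z ∈ K ↔ φ z ≤ 0)) :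
    IsNormalChart K x (fun z => ‖gradient φ z‖⁻¹ • gradient φ z) := by
  have hg : gradient φ x ≠ 0 := fun h0 => hd (by
    ext v
    rw [← inner_gradient, h0]
    simp)
  have hgC := contDiffAt_gradient hφ2
  have hnC : ContDiffAt ℝ 1 (fun z => ‖gradient φ z‖⁻¹) x :=
    (hgC.norm ℝ hg).inv (norm_ne_zero_iff.2 hg)
  refine ⟨hnC.smul hgC, ?_, ?_⟩
  · have h1 : ∀ᶠ y in 𝓝 x, ContDiffAt ℝ 2 φ y := hφ2.eventually (by simp)
    have h2 : ∀ᶠ y in 𝓝 x, gradient φ y ≠ 0 := hgC.continuousAt.eventually_ne hg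
    filter_upwards [nhdsWithin_le_nhds h1, nhdsWithin_le_nhds h2,
      nhdsWithin_le_nhds (eventually_eventually_nhds.2 hφ), self_mem_nhdsWithin]
      with y hy1 hy2 hy3 hyK u hu
    exact hu.eq_normalize_gradient (hy1.differentiableAt (by norm_num))
      (eq_zero_of_mem_frontier hy1.continuousAt hy3 hK hyK) hy2 hy3
  · intro v w hv hw
    have hpos : ‖gradient φ x‖⁻¹ ≠ 0 := inv_ne_zero (norm_ne_zero_iff.2 hg)
    rw [real_inner_smul_right, mul_eq_zero, or_iff_right hpos] at hv hw
    have hder := (hnC.differentiableAt (by norm_num)).hasFDerivAt.smul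
      (hgC.differentiableAt (by norm_num)).hasFDerivAt
    -- Differentiating the normalizing factor contributes only a multiple of the gradient, which a
    -- tangent `b` does not see.
    have key : ∀ a b, ⟪gradient φ x, b⟫ = 0 →
        ⟪fderiv ℝ (fun z => ‖gradient φ z‖⁻¹ • gradient φ z) x a, b⟫ =
          ‖gradient φ x‖⁻¹ * ⟪fderiv ℝ (gradient φ) x a, b⟫ := by
      intro a b hb
      erw [hder.fderiv]
      simp [inner_add_left, real_inner_smul_left, hb]
    rw [key v w (by rwa [real_inner_comm]), inner_fderiv_gradient_symm hφ2,
      real_inner_comm, ← key w v (by rwa [real_inner_comm]), real_inner_comm]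

theorem IsC2PlusBody.isRegularBody (hK : IsC2PlusBody K) (h0 : (0 : E n) ∈ interior K) :
    IsRegularBody K := by
  refine ⟨hK.1.1, hK.1.2.1, h0, fun x hx => ?_⟩
  obtain ⟨φ, h1, h2, h3⟩ := hK.2.1 x hx
  exact ⟨_, isNormalChart_normalize_gradient hK.1.2.1.isClosed h1 h2 h3⟩

/-- The boundary of a `C²₊` body is locally the zero set of a `C¹` function which is transversal
to the radial direction. -/
theorem IsC2PlusBody.exists_defining_function (hK : IsC2PlusBody K)
    (h0 : (0 : E n) ∈ interior K) (hx : x ∈ frontier K) :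
    ∃ ρ : E n → ℝ, ContDiffAt ℝ 1 ρ x ∧ fderiv ℝ ρ x x ≠ 0 ∧
      ∀ᶠ y in 𝓝[frontier K] x, ρ y = 0 := by
  obtain ⟨φ, h1, h2, h3⟩ := hK.2.1 x hx
  have hclosed := hK.1.2.1.isClosed
  refine ⟨φ, h1.of_le (by norm_num), ?_, ?_⟩
  -- The derivative of `φ` at `x` in the direction `x` is `‖∇φ‖ ⟪x, N(x)⟫`, positive since `0` is
  -- interior.
  · have hu := isOuterUnitNormal_gaussMap hK.1.1 hK.1.2.2 hx
    have hpos := inner_pos_of_isOuterUnitNormal h0 hu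
    have hg : gradient φ x ≠ 0 := fun h0 => h2 (by
      ext v
      rw [← inner_gradient, h0]
      simp)
    rw [hu.eq_normalize_gradient (h1.differentiableAt (by norm_num))
      (eq_zero_of_mem_frontier h1.continuousAt h3 hclosed hx) hg h3, real_inner_smul_right,
      real_inner_comm, inner_gradient] at hpos
    intro h
    rw [h, mul_zero] at hpos
    exact hpos.false
  · filter_upwards [nhdsWithin_le_nhds (h1.eventually (by simp)),
      nhdsWithin_le_nhds (eventually_eventually_nhds.2 h3), self_mem_nhdsWithin] with y hy1 hy2 hyK
    exact eq_zero_of_mem_frontier hy1.continuousAt hy2 hclosed hyK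

end DefiningFunction

/-! ### Polar duality of boundary points and strict convexity -/

section PolarBasic

variable {K : Set (E n)} {x x' y u : E n}

theorem convex_polarBody (K : Set (E n)) : Convex ℝ (polarBody K) := by
  intro y hy z hz a b ha hb hab x hx
  rw [inner_add_left, real_inner_smul_left, real_inner_smul_left]
  nlinarith [hy x hx, hz x hx]

theorem isClosed_polarBody (K : Set (E n)) : IsClosed (polarBody K) := by
  have : polarBody K = ⋂ x ∈ K, {y | ⟪y, x⟫ ≤ 1} := by
    ext y
    simp [polarBody]
  rw [this]
  exact isClosed_biInter fun x _ => isClosed_le (by fun_prop) continuous_const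

theorem isCompact_polarBody (h0 : (0 : E n) ∈ interior K) : IsCompact (polarBody K) := by
  obtain ⟨r, hr, hrK⟩ := Metric.mem_nhds_iff.1 (mem_interior_iff_mem_nhds.1 h0)
  refine Metric.isCompact_of_isClosed_isBounded (isClosed_polarBody K)
    (isBounded_iff_forall_norm_le.2 ⟨2 / r, fun y hy => ?_⟩)
  rcases eq_or_ne y 0 with rfl | hy0
  · simp only [norm_zero]; positivity
  have hny : 0 < ‖y‖ := norm_pos_iff.2 hy0
  have h1 := hy ((r / 2 / ‖y‖) • y) (hrK (by
    rw [mem_ball_zero_iff, norm_smul, Real.norm_of_nonneg (by positivity),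
      div_mul_cancel₀ _ hny.ne']
    linarith))
  rw [real_inner_smul_right, real_inner_self_eq_norm_sq] at h1
  rw [le_div_iff₀ hr]
  have h2 : r / 2 / ‖y‖ * ‖y‖ ^ 2 = r / 2 * ‖y‖ := by field_simp
  linarith

theorem mem_interior_polarBody (hK : IsCompact K) (h : ∀ x ∈ K, ⟪y, x⟫ < 1) :
    y ∈ interior (polarBody K) := by
  rw [mem_interior_iff_mem_nhds]
  have : ∀ᶠ y' in 𝓝 y, ∀ x ∈ K, ⟪y', x⟫ < 1 := by
    refine hK.eventually_forall_of_forall_eventually fun x hx => ?_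
    have hc : Continuous fun z : E n × E n => ⟪z.1, z.2⟫ := by fun_prop
    exact hc.continuousAt.eventually (gt_mem_nhds (h x hx))
  filter_upwards [this] with y' hy' x hx using (hy' x hx).le

theorem zero_mem_interior_polarBody (hK : IsCompact K) : (0 : E n) ∈ interior (polarBody K) :=
  mem_interior_polarBody hK fun x _ => by simp

theorem exists_inner_eq_one (hK : IsCompact K) (hy : y ∈ frontier (polarBody K)) :
    ∃ x ∈ K, ⟪y, x⟫ = 1 := by
  by_contra! hcon
  have hyL : y ∈ polarBody K := (isClosed_polarBody K).frontier_subset hy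
  exact hy.2 (mem_interior_polarBody hK fun x hx => lt_of_le_of_ne (hyL x hx) (hcon x hx))

theorem ne_zero_of_inner_eq_one (h : ⟪y, x⟫ = 1) : y ≠ 0 ∧ x ≠ 0 := by
  constructor <;> rintro rfl <;> simp at h

/-- The relation `⟪y, x⟫ = 1` encodes duality of boundary points: the half-space `⟪y, ·⟫ ≤ 1` then
supports `K` at `x`. -/
theorem isOuterUnitNormal_of_inner_eq_one (hy : y ∈ polarBody K) (h : ⟪y, x⟫ = 1) :
    IsOuterUnitNormal K x (‖y‖⁻¹ • y) := by
  have hy0 := (ne_zero_of_inner_eq_one h).1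
  refine ⟨by rw [norm_smul, norm_inv, norm_norm, inv_mul_cancel₀ (norm_ne_zero_iff.2 hy0)],
    fun z hz => ?_⟩
  rw [real_inner_smul_right, inner_sub_left, real_inner_comm, real_inner_comm _ x, h]
  exact mul_nonpos_of_nonneg_of_nonpos (by positivity) (sub_nonpos.2 (hy z hz))

theorem mem_frontier_of_isOuterUnitNormal (hx : x ∈ K) (hu : IsOuterUnitNormal K x u) :
    x ∈ frontier K := by
  refine ⟨subset_closure hx, fun hi => ?_⟩
  obtain ⟨r, hr, hrK⟩ := Metric.mem_nhds_iff.1 (mem_interior_iff_mem_nhds.1 hi)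
  have h1 := hu.2 (x + (r / 2) • u) (hrK (by
    rw [mem_ball_iff_norm, add_sub_cancel_left, norm_smul, hu.1, mul_one,
      Real.norm_of_nonneg (by positivity)]
    linarith))
  rw [add_sub_cancel_left, real_inner_smul_left, real_inner_self_eq_norm_sq, hu.1] at h1
  linarith

/-- A body with nondegenerate second fundamental form is strictly convex. -/
theorem IsRegularBody.eq_of_inner_eq_one (hK : IsRegularBody K)
    (hpos : ∀ x ∈ frontier K, 0 < gaussCurv K x) (hy : y ∈ polarBody K) (hx : x ∈ K)
    (hx' : x' ∈ K) (h : ⟪y, x⟫ = 1) (h' : ⟪y, x'⟫ = 1) : x' = x := by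
  have hu := isOuterUnitNormal_of_inner_eq_one hy h
  have hxf := mem_frontier_of_isOuterUnitNormal hx hu
  obtain ⟨G, hG⟩ := hK.exists_chart x hxf
  have hGx : ‖y‖⁻¹ • y = G x := hG.eq_normal.self_of_nhdsWithin hxf _ hu
  set v := x' - x with hv
  have hline : Tendsto (fun t : ℝ => t • v) (𝓝[>] 0) (𝓝 0) := by
    have : Tendsto (fun t : ℝ => t • v) (𝓝 0) (𝓝 ((0 : ℝ) • v)) :=
      Continuous.tendsto (by fun_prop) 0
    rw [zero_smul] at this
    exact this.mono_left nhdsWithin_le_nhds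
  -- The segment from `x` towards `x'` lies in the face `⟪y, ·⟫ = 1`, so the normal is constant
  -- along it and the derivative of `G` kills `v`; nondegeneracy then gives `v = 0`.
  have hseg : ∀ᶠ t in 𝓝[>] (0 : ℝ), x + t • v ∈ frontier K ∧
      IsOuterUnitNormal K (x + t • v) (‖y‖⁻¹ • y) := by
    filter_upwards [self_mem_nhdsWithin, nhdsWithin_le_nhds (gt_mem_nhds one_pos)] with t ht ht1
    have hmem : x + t • v ∈ K := hK.convex.add_smul_sub_mem hx hx' ⟨le_of_lt ht, le_of_lt ht1⟩
    have hin : ⟪y, x + t • v⟫ = 1 := by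
      rw [hv, inner_add_right, real_inner_smul_right, inner_sub_right, h, h']; ring
    have := isOuterUnitNormal_of_inner_eq_one hy hin
    exact ⟨mem_frontier_of_isOuterUnitNormal hmem this, this⟩
  have hlim := hG.hasFDerivAt.hasFDerivWithinAt.lim (c := fun t : ℝ => t⁻¹) hline
    (hseg.mono fun t ht => ht.1) (v := v) (by
      refine tendsto_const_nhds.congr' ?_
      filter_upwards [self_mem_nhdsWithin] with t ht
      rw [inv_smul_smul₀ (ne_of_gt ht)])
  have hconst : ∀ᶠ t in 𝓝[>] (0 : ℝ), t⁻¹ • (G (x + t • v) - G x) = 0 := by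
    have ht : Tendsto (fun t : ℝ => x + t • v) (𝓝[>] 0) (𝓝[frontier K] x) :=
      tendsto_nhdsWithin_iff.2 ⟨by simpa using hline.const_add x, hseg.mono fun t ht => ht.1⟩
    filter_upwards [ht.eventually hG.eq_normal, hseg] with t h1 h2
    rw [← h1 _ h2.2, ← hGx, sub_self, smul_zero]
  have hzero : fderiv ℝ G x v = 0 :=
    tendsto_nhds_unique hlim (tendsto_const_nhds.congr' (hconst.mono fun t ht => ht.symm))
  have hvT : ⟪v, gaussMap K x⟫ = 0 := by
    rw [hG.gaussMap_eq hK hxf, ← hGx, real_inner_smul_right, hv, real_inner_comm,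
      inner_sub_right, h, h', sub_self, mul_zero]
  exact sub_eq_zero.1 ((hG.gaussCurv_pos_iff hK hxf).1 (hpos x hxf) v hvT
    fun w _ => by rw [hzero, inner_zero_left])

/-- The outward normal of the polar body at `y` points to the point of `K` dual to `y`. -/
theorem IsRegularBody.normal_polarBody (hK : IsRegularBody K)
    (hpos : ∀ x ∈ frontier K, 0 < gaussCurv K x) (hy : y ∈ polarBody K) (hx : x ∈ K)
    (h : ⟪y, x⟫ = 1) (hu : IsOuterUnitNormal (polarBody K) y u) : u = ‖x‖⁻¹ • x := by
  have hc : 0 < ⟪y, u⟫ :=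
    inner_pos_of_isOuterUnitNormal (zero_mem_interior_polarBody hK.isCompact) hu
  set c := ⟪y, u⟫ with hcdef
  -- This is the bipolar argument: a functional separating `c⁻¹ • u` from `K`, rescaled, would be a
  -- point of `K°` violating the support inequality at `y`.
  have hmem : c⁻¹ • u ∈ K := by
    by_contra hcon
    obtain ⟨f, s, hf, hs⟩ :=
      geometric_hahn_banach_closed_point hK.convex hK.isCompact.isClosed hcon
    have hs0 : 0 < s := by simpa using hf 0 (interior_subset hK.zero_mem)
    set w := (InnerProductSpace.toDual ℝ (E n)).symm f with hw
    have hfw : ∀ z, f z = ⟪w, z⟫ := fun z => (InnerProductSpace.toDual_symm_apply).symm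
    have hz : s⁻¹ • w ∈ polarBody K := fun a ha => by
      rw [real_inner_smul_left, ← hfw, inv_mul_le_iff₀ hs0, mul_one]
      exact (hf a ha).le
    have h1 := hu.2 _ hz
    rw [inner_sub_left, real_inner_smul_left, ← hfw, ← hcdef, sub_nonpos,
      inv_mul_le_iff₀ hs0] at h1
    rw [map_smul, smul_eq_mul, inv_mul_eq_div, lt_div_iff₀ hc] at hs
    linarith
  have hone : ⟪y, c⁻¹ • u⟫ = 1 := by
    rw [real_inner_smul_right, ← hcdef, inv_mul_cancel₀ hc.ne']
  have heq := hK.eq_of_inner_eq_one hpos hy hx hmem h hone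
  have hn : ‖x‖ = c⁻¹ := by
    rw [← heq, norm_smul, hu.1, mul_one, Real.norm_of_nonneg (by positivity)]
  rw [hn, ← heq, inv_inv, smul_inv_smul₀ hc.ne']

/-- The point of `K` dual to a boundary point of the polar body depends continuously on it. -/
theorem IsRegularBody.eventually_dual_mem (hK : IsRegularBody K)
    (hpos : ∀ x ∈ frontier K, 0 < gaussCurv K x) (hy : y ∈ polarBody K) (hx : x ∈ K)
    (h : ⟪y, x⟫ = 1) {U : Set (E n)} (hU : U ∈ 𝓝[frontier K] x) :
    ∀ᶠ z in 𝓝[frontier (polarBody K)] y, ∀ a ∈ K, ⟪z, a⟫ = 1 → a ∈ U := by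
  obtain ⟨V, hVo, hxV, hVU⟩ := mem_nhdsWithin.1 hU
  have hcomp : IsCompact (K \ V) := hK.isCompact.diff hVo
  -- As `x` is the only contact point for `y`, the inequality is strict on the compact set `K \ V`,
  -- and it stays strict for `z` near `y`.
  have h1 : ∀ᶠ z in 𝓝 y, ∀ a ∈ K \ V, ⟪z, a⟫ < 1 := by
    refine hcomp.eventually_forall_of_forall_eventually fun a ha => ?_
    have hc : Continuous fun z : E n × E n => ⟪z.1, z.2⟫ := by fun_prop
    refine hc.continuousAt.eventually (gt_mem_nhds (lt_of_le_of_ne (hy a ha.1) fun hcon => ?_))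
    exact ha.2 (by rwa [hK.eq_of_inner_eq_one hpos hy hx ha.1 h hcon])
  filter_upwards [nhdsWithin_le_nhds h1, self_mem_nhdsWithin] with z hz hzL a ha hza
  have hzL' : z ∈ polarBody K := (isClosed_polarBody K).frontier_subset hzL
  refine hVU ⟨?_, mem_frontier_of_isOuterUnitNormal ha
    (isOuterUnitNormal_of_inner_eq_one hzL' hza)⟩
  by_contra hcon
  exact (hz a ⟨ha, hcon⟩).ne hza

end PolarBasic

/-! ### The polar body through the inverse function theorem -/

section PolarChart

variable {K : Set (E n)} {x y : E n} {G : E n → E n} {ρ : E n → ℝ}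

/-- The duality map `z ↦ G z / ⟪z, G z⟫` from `∂K` to the boundary of the polar body extends to
a local `C¹` diffeomorphism; this gives its local inverse, together with the properties of the
differential. -/
theorem IsNormalChart.exists_dual_inverse (hG : IsNormalChart K x G) (hK : IsRegularBody K)
    (hx : x ∈ frontier K) (hpos : 0 < gaussCurv K x) (hρ : ContDiffAt ℝ 1 ρ x)
    (hρx : fderiv ℝ ρ x x ≠ 0) (hρ0 : ∀ᶠ z in 𝓝[frontier K] x, ρ z = 0) :
    ∃ (g : E n → E n) (e : E n ≃L[ℝ] E n),
      ContDiffAt ℝ 1 g (⟪x, G x⟫⁻¹ • G x) ∧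
      HasFDerivAt g (e.symm : E n →L[ℝ] E n) (⟪x, G x⟫⁻¹ • G x) ∧
      g (⟪x, G x⟫⁻¹ • G x) = x ∧
      (∀ᶠ z in 𝓝[frontier K] x, g (⟪z, G z⟫⁻¹ • G z) = z) ∧
      (∀ v, ⟪e v, x⟫ = ⟪x, G x⟫⁻¹ * ⟪v, G x⟫) ∧
      ∀ v w, ⟪v, G x⟫ = 0 → ⟪w, G x⟫ = 0 →
        ⟪e v, w⟫ = ⟪x, G x⟫⁻¹ * ⟪fderiv ℝ G x v, w⟫ := by
  have hN : gaussMap K x = G x := hG.gaussMap_eq hK hx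
  have hh : 0 < ⟪x, G x⟫ := by
    have := hK.supp_pos hx
    rwa [supp, hN] at this
  set N := G x with hNdef
  set h := ⟪x, N⟫ with hhdef
  set D := fderiv ℝ G x with hD
  set c := fderiv ℝ ρ x x with hc
  have hρx0 : ρ x = 0 := hρ0.self_of_nhdsWithin hx
  have hρd : HasFDerivAt ρ (fderiv ℝ ρ x) x := (hρ.differentiableAt (by norm_num)).hasFDerivAt
  have hρT : ∀ v, ⟪v, N⟫ = 0 → fderiv ℝ ρ x v = 0 := by
    intro v hv
    have h1 : HasFDerivWithinAt ρ (0 : E n →L[ℝ] ℝ) (frontier K) x :=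
      (hasFDerivWithinAt_const (0 : ℝ) x (frontier K)).congr_of_eventuallyEq hρ0 hρx0
    exact hρd.hasFDerivWithinAt.unique_on h1 (hK.mem_tangentConeAt hx (by rwa [hN]))
  -- The derivative of `ρ` vanishes on the tangent plane, and `v - (⟪v, N⟫/h) x` is tangent, so the
  -- value `c` at `x` determines it.
  have hρv : ∀ v, fderiv ℝ ρ x v = h⁻¹ * ⟪v, N⟫ * c := by
    intro v
    have h1 := hρT (v - (h⁻¹ * ⟪v, N⟫) • x) (by
      rw [inner_sub_left, real_inner_smul_left, ← hhdef]
      field_simp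
      ring)
    rw [map_sub, map_smul, smul_eq_mul, sub_eq_zero] at h1
    exact h1
  let s : E n → ℝ := fun z => ⟪z, G z⟫
  let ψ : E n → E n := fun z => (s z)⁻¹ • G z
  -- The factor is `1` on `∂K` near `x`, so `Φ` extends the duality map. From `⟪ψ z, z⟫ = 1`, the
  -- derivative of `ψ` paired with `x` is `-h⁻¹ ⟪v, N⟫`; the factor adds `2 h⁻¹ ⟪v, N⟫` and reverses
  -- the sign.
  let Φ : E n → E n := fun z => (1 + 2 / c * ρ z) • ψ z
  have hsC : ContDiffAt ℝ 1 s x := contDiffAt_id.inner ℝ hG.contDiffAt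
  have hΦC : ContDiffAt ℝ 1 Φ x :=
    (contDiffAt_const.add (contDiffAt_const.mul hρ)).smul
      ((hsC.inv hh.ne').smul hG.contDiffAt)
  have hΦx : Φ x = h⁻¹ • N := by simp [Φ, hρx0, ψ, s, hhdef, hNdef]
  have hA : ∀ v, fderiv ℝ Φ x v =
      h⁻¹ • D v - (h⁻¹ ^ 2 * (⟪v, N⟫ + ⟪x, D v⟫)) • N + (2 * h⁻¹ ^ 2 * ⟪v, N⟫) • N := by
    intro v
    have hs' : HasFDerivAt s _ x := (hasFDerivAt_id x).inner ℝ hG.hasFDerivAt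
    have hψ' := ((hasDerivAt_inv (x := s x) hh.ne').comp_hasFDerivAt x hs').fun_smul
      hG.hasFDerivAt
    have hΦ' := ((hρd.const_mul (2 / c)).const_add 1).fun_smul hψ'
    rw [show fderiv ℝ Φ x = _ from hΦ'.fderiv]
    simp [hρx0, s, hρv v, ← hNdef, ← hhdef, ← hD, fderivInnerCLM_apply]
    match_scalars <;> field_simp
    ring
  have hAx : ∀ v, ⟪fderiv ℝ Φ x v, x⟫ = h⁻¹ * ⟪v, N⟫ := by
    intro v
    rw [hA, inner_add_left, inner_sub_left, real_inner_smul_left, real_inner_smul_left,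
      real_inner_smul_left, real_inner_comm x N, ← hhdef, real_inner_comm x (D v)]
    field_simp
    ring
  have hAT : ∀ v w, ⟪v, N⟫ = 0 → ⟪w, N⟫ = 0 → ⟪fderiv ℝ Φ x v, w⟫ = h⁻¹ * ⟪D v, w⟫ := by
    intro v w hv hw
    rw [real_inner_comm] at hw
    simp only [hA, inner_add_left, inner_sub_left, real_inner_smul_left, hw]
    ring
  -- For `v` in the kernel, pairing with `x` shows that `v` is tangent; pairing with tangent vectors
  -- then puts it in the radical of the nondegenerate second fundamental form.
  have hinj : Function.Injective (fderiv ℝ Φ x : E n →ₗ[ℝ] E n) := by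
    rw [← LinearMap.ker_eq_bot, LinearMap.ker_eq_bot']
    intro v hv
    replace hv : fderiv ℝ Φ x v = 0 := hv
    have hvN : ⟪v, N⟫ = 0 := by
      have := hAx v
      rw [hv, inner_zero_left, eq_comm, mul_eq_zero] at this
      exact this.resolve_left (inv_ne_zero hh.ne')
    refine (hG.gaussCurv_pos_iff hK hx).1 hpos v (by rwa [hN]) fun w hw => ?_
    rw [hN] at hw
    have := hAT v w hvN hw
    rw [hv, inner_zero_left, eq_comm, mul_eq_zero] at this
    exact this.resolve_left (inv_ne_zero hh.ne')
  let e : E n ≃L[ℝ] E n :=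
    (LinearEquiv.ofInjectiveEndo (fderiv ℝ Φ x : E n →ₗ[ℝ] E n) hinj).toContinuousLinearEquiv
  have he : ∀ v, e v = fderiv ℝ Φ x v := fun v => rfl
  have hΦd : HasFDerivAt Φ (e : E n →L[ℝ] E n) x := by
    have : (e : E n →L[ℝ] E n) = fderiv ℝ Φ x := by
      ext1 v
      exact he v
    rw [this]
    exact (hΦC.differentiableAt (by norm_num)).hasFDerivAt
  have hstrict : HasStrictFDerivAt Φ (e : E n →L[ℝ] E n) x :=
    hΦC.hasStrictFDerivAt' hΦd (by norm_num)
  have hleft := hstrict.eventually_left_inverse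
  refine ⟨hΦC.localInverse hΦd (by norm_num), e, ?_, ?_, ?_, ?_, fun v => by rw [he, hAx],
    fun v w hv hw => by rw [he, hAT v w hv hw]⟩
  · rw [← hΦx]
    exact hΦC.to_localInverse hΦd (by norm_num)
  · rw [← hΦx]
    exact hstrict.to_localInverse.hasFDerivAt
  · rw [← hΦx]
    exact hleft.self_of_nhds
  · filter_upwards [nhdsWithin_le_nhds hleft, hρ0] with z hz hz0
    have : Φ z = ⟪z, G z⟫⁻¹ • G z := by simp [Φ, hz0, ψ, s]
    rw [← this]
    exact hz

/-- The normal of `K°` at a boundary point is the direction of its dual point in `K`, so the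
normalized local inverse `g/‖g‖` is a chart. Its second fundamental form is that of `K` pulled back
by `e.symm`, times `‖x‖⁻¹ ⟪x, G x⟫⁻¹ > 0`, so symmetry and nondegeneracy carry over. -/
theorem IsRegularBody.exists_polar_chart (hK : IsRegularBody K)
    (hpos : ∀ x ∈ frontier K, 0 < gaussCurv K x)
    (hdef : ∀ x ∈ frontier K, ∃ ρ : E n → ℝ, ContDiffAt ℝ 1 ρ x ∧ fderiv ℝ ρ x x ≠ 0 ∧
      ∀ᶠ y in 𝓝[frontier K] x, ρ y = 0) (hy : y ∈ frontier (polarBody K)) :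
    ∃ F, IsNormalChart (polarBody K) y F ∧ ∀ v, ⟪v, F y⟫ = 0 →
      (∀ w, ⟪w, F y⟫ = 0 → ⟪fderiv ℝ F y v, w⟫ = 0) → v = 0 := by
  have hyL : y ∈ polarBody K := (isClosed_polarBody K).frontier_subset hy
  obtain ⟨x, hxK, hxy⟩ := exists_inner_eq_one hK.isCompact hy
  have hx : x ∈ frontier K :=
    mem_frontier_of_isOuterUnitNormal hxK (isOuterUnitNormal_of_inner_eq_one hyL hxy)
  obtain ⟨G, hG⟩ := hK.exists_chart x hx
  obtain ⟨ρ, hρ, hρx, hρ0⟩ := hdef x hx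
  obtain ⟨g, e, hgC, hgd, hgx, hginv, hex, heT⟩ :=
    hG.exists_dual_inverse hK hx (hpos x hx) hρ hρx hρ0
  have hN : gaussMap K x = G x := hG.gaussMap_eq hK hx
  have hh : 0 < ⟪x, G x⟫ := by
    have := hK.supp_pos hx
    rwa [supp, hN] at this
  have hx0 : x ≠ 0 := (ne_zero_of_inner_eq_one hxy).2
  have hnx : ‖x‖⁻¹ ≠ 0 := inv_ne_zero (norm_ne_zero_iff.2 hx0)
  -- Here `G a = z/‖z‖` and `⟪a, G a⟫ = 1/‖z‖`, so the duality map returns `z`.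
  have hdual : ∀ z a, z ∈ polarBody K → ⟪z, a⟫ = 1 →
      (∀ u, IsOuterUnitNormal K a u → u = G a) → ⟪a, G a⟫⁻¹ • G a = z := by
    intro z a hz hza hu
    have hz0 : ‖z‖ ≠ 0 := norm_ne_zero_iff.2 (ne_zero_of_inner_eq_one hza).1
    rw [← hu _ (isOuterUnitNormal_of_inner_eq_one hz hza), real_inner_smul_right,
      real_inner_comm, hza, mul_one, inv_inv, smul_inv_smul₀ hz0]
  have hxy' : ⟪x, G x⟫⁻¹ • G x = y := hdual y x hyL hxy (hG.eq_normal.self_of_nhdsWithin hx)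
  rw [hxy'] at hgC hgd hgx
  have hgx0 : g y ≠ 0 := by rwa [hgx]
  have hnC : ContDiffAt ℝ 1 (fun z => ‖g z‖⁻¹) y :=
    (hgC.norm ℝ hgx0).inv (norm_ne_zero_iff.2 hgx0)
  have hF : ∀ v w, ⟪w, x⟫ = 0 → ⟪fderiv ℝ (fun z => ‖g z‖⁻¹ • g z) y v, w⟫ =
      ‖x‖⁻¹ * ⟪e.symm v, w⟫ := by
    intro v w hw
    have hder := (hnC.differentiableAt (by norm_num)).hasFDerivAt.fun_smul hgd
    rw [hder.fderiv]
    rw [real_inner_comm] at hw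
    simp [inner_add_left, real_inner_smul_left, hgx, hw]
  have hsymmT : ∀ v, ⟪v, x⟫ = 0 → ⟪e.symm v, G x⟫ = 0 := by
    intro v hv
    have := hex (e.symm v)
    rw [e.apply_symm_apply, hv, eq_comm, mul_eq_zero] at this
    exact this.resolve_left (inv_ne_zero hh.ne')
  have hform : ∀ v w, ⟪v, x⟫ = 0 → ⟪w, x⟫ = 0 →
      ⟪fderiv ℝ (fun z => ‖g z‖⁻¹ • g z) y v, w⟫ =
        ‖x‖⁻¹ * (⟪x, G x⟫⁻¹ * ⟪fderiv ℝ G x (e.symm v), e.symm w⟫) := by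
    intro v w hv hw
    have h1 := heT (e.symm w) (e.symm v) (hsymmT w hw) (hsymmT v hv)
    rw [e.apply_symm_apply] at h1
    rw [hF v w hw, real_inner_comm, h1, hG.symm _ _ (hsymmT w hw) (hsymmT v hv),
      real_inner_comm (fderiv ℝ G x (e.symm v))]
  have hperp : ∀ v, ⟪v, ‖g y‖⁻¹ • g y⟫ = 0 ↔ ⟪v, x⟫ = 0 := by
    intro v
    rw [hgx, real_inner_smul_right, mul_eq_zero, or_iff_right hnx]
  refine ⟨fun z => ‖g z‖⁻¹ • g z, ⟨hnC.smul hgC, ?_, ?_⟩, ?_⟩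
  · have hU := hK.eventually_dual_mem hpos hyL hxK hxy (hginv.and hG.eq_normal)
    filter_upwards [hU, self_mem_nhdsWithin] with z hz hzL u hu
    have hzL' : z ∈ polarBody K := (isClosed_polarBody K).frontier_subset hzL
    obtain ⟨a, haK, hza⟩ := exists_inner_eq_one hK.isCompact hzL
    obtain ⟨h1, h2⟩ := hz a haK hza
    rw [hdual z a hzL' hza h2] at h1
    rw [h1]
    exact hK.normal_polarBody hpos hzL' haK hza hu
  · intro v w hv hw
    rw [hperp] at hv hw
    rw [hform v w hv hw, real_inner_comm _ v, hform w v hw hv,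
      hG.symm _ _ (hsymmT v hv) (hsymmT w hw),
      real_inner_comm (fderiv ℝ G x (e.symm w))]
  · intro v hv hvw
    rw [hperp] at hv
    have h0 : e.symm v = 0 := by
      refine (hG.gaussCurv_pos_iff hK hx).1 (hpos x hx) _ (by rw [hN]; exact hsymmT v hv)
        fun w hw => ?_
      rw [hN] at hw
      have hew : ⟪e w, x⟫ = 0 := by rw [hex, hw, mul_zero]
      have h1 := hvw (e w) ((hperp _).2 hew)
      rw [hform v (e w) hv hew, e.symm_apply_apply, mul_eq_zero, or_iff_right hnx, mul_eq_zero,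
        or_iff_right (inv_ne_zero hh.ne')] at h1
      exact h1
    exact e.symm.map_eq_zero_iff.1 h0

theorem IsRegularBody.polarBody (hK : IsRegularBody K)
    (hpos : ∀ x ∈ frontier K, 0 < gaussCurv K x)
    (hdef : ∀ x ∈ frontier K, ∃ ρ : E n → ℝ, ContDiffAt ℝ 1 ρ x ∧ fderiv ℝ ρ x x ≠ 0 ∧
      ∀ᶠ y in 𝓝[frontier K] x, ρ y = 0) :
    IsRegularBody (polarBody K) ∧
      ∀ y ∈ frontier (WeightedAffineSurface.polarBody K),
        0 < gaussCurv (WeightedAffineSurface.polarBody K) y := by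
  have hreg : IsRegularBody (WeightedAffineSurface.polarBody K) :=
    ⟨convex_polarBody K, isCompact_polarBody hK.zero_mem,
      zero_mem_interior_polarBody hK.isCompact, fun y hy => by
        obtain ⟨F, hF, -⟩ := hK.exists_polar_chart hpos hdef hy
        exact ⟨F, hF⟩⟩
  refine ⟨hreg, fun y hy => ?_⟩
  obtain ⟨F, hF, hnd⟩ := hK.exists_polar_chart hpos hdef hy
  rw [hF.gaussCurv_pos_iff hreg hy, hF.gaussMap_eq hreg hy]
  exact hnd

end PolarChart

end WeightedAffineSurface
theorem theorem3p8 (n : ℕ) (hn : 1 ≤ n) (m k : ℕ) (i : ℕ → ℕ)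
    (hi : ∑ j ∈ Finset.Icc 1 (n - 1), j * i j = m)
    (K : Set (EuclideanSpace ℝ (Fin n))) (hK : IsC2PlusBody K)
    (hcentroid : (volume.real K)⁻¹ • (∫ x in K, x) = 0) :
    (Integrable (klIntegrand (densP K) (densQ K)) (weightMeasure m k i K) ∧
      Tendsto (fun p : ℝ => (omega m k i p K / omegaInfty m k i K) ^ ((n : ℝ) + p)) atTop
        (𝓝 (Real.exp (-((n : ℝ) * klDivergence (weightMeasure m k i K) (densP K) (densQ K) /
          omegaInfty m k i K))))) ∧
    (Integrable (klIntegrand (densQ (polarBody K)) (densP (polarBody K)))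
        (weightMeasure m k i (polarBody K)) ∧
      Tendsto (fun p : ℝ => (omega m k i p (polarBody K) / omega m k i 0 (polarBody K)) ^
          ((n : ℝ) * ((n : ℝ) + p) / p)) (𝓝[≠] 0)
        (𝓝 (Real.exp (-((n : ℝ) * klDivergence (weightMeasure m k i (polarBody K))
          (densQ (polarBody K)) (densP (polarBody K)) / omega m k i 0 (polarBody K)))))) := by
  -- The centroid condition enters only through `0 ∈ interior K`.
  have h0 := zero_mem_interior_of_centroid hK.1 hcentroid
  have hreg := hK.isRegularBody h0
  obtain ⟨hregP, hposP⟩ := hreg.polarBody hK.2.2 fun x hx => hK.exists_defining_function h0 hx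
  have := hreg.isFiniteMeasure_weightMeasure hK.2.2 (m := m) (k := k) (i := i)
  have := hreg.neZero_weightMeasure hn hK.2.2 (m := m) (k := k) (i := i)
  have := hregP.isFiniteMeasure_weightMeasure hposP (m := m) (k := k) (i := i)
  have := hregP.neZero_weightMeasure hn hposP (m := m) (k := k) (i := i)
  exact ⟨integrable_klIntegrand_and_tendsto_atTop hn (hreg.gaussCurv_aePosBounded hK.2.2)
      hreg.supp_aePosBounded,
    integrable_klIntegrand_and_tendsto_zero hn (hregP.gaussCurv_aePosBounded hposP)
      hregP.supp_aePosBounded⟩
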